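/- **Partitions and Schur functions.** A partition $\lambda=(\lambda_1\ge\lambda_2\ge\dots\ge 0)$ has finitely many non-zero parts, $\lambda'$ denotes its dual, and $\lambda$ is even if all its parts are even. For finitely many nonnegative variables $\rho=(x_1,\dots,x_m)$ let $s_{\lambda/\mu}(\rho)$ be the skew Schur function evaluated at these variables ($0$ unless $\mu\subset\lambda$, and $\mathbf 1_{\lambda=\mu}$ if $m=0$), $s_\lambda=s_{\lambda/\varnothing}$, and $\tau_\lambda(\rho)=\sum_{\kappa:\ \kappa'\text{ even}}s_{\lambda/\kappa}(\rho)$. The *Pfaffian Schur process* $\mathbf{PSP}[\rho_0^+;\dots;\rho_{n-1}^+\,|\,\rho_1^-;\dots;\rho_n^-]$ is the probability measure on sequences of partitions $\varnothing\subset\lambda^{(1)}\supset\mu^{(1)}\subset\lambda^{(2)}\supset\dots\supset\mu^{(n-1)}\subset\lambda^{(n)}\supset\varnothing$ with probabilities proportional to $$\tau_{\lambda^{(1)}}(\rho_0^+)\,\Big(\prod_{k=1}^{n-1}s_{\lambda^{(k)}/\mu^{(k)}}(\rho_k^-)\,s_{\lambda^{(k+1)}/\mu^{(k)}}(\rho_k^+)\Big)\,s_{\lambda^{(n)}}(\rho_n^-).$$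 **Zig-zag paths.** Let $\Omega$ be the set of lattice paths which start on the horizontal axis, go by unit steps to the left or upwards, hit the diagonal at some point $(N,N)$ with $N\ge1$, and then take one last edge from $(N,N)$ to $(0,0)$. Given $\gamma\in\Omega$ whose unit edges $e$ are labelled by finite lists of variables $\rho_e$ and whose diagonal edge is labelled by $\rho_\circ$, the *Pfaffian Schur process indexed by $\gamma$* is the probability measure on families of partitions $(\lambda^v)$ indexed by the vertices $v$ of $\gamma$, with $\lambda^v=\varnothing$ for $v$ on the horizontal axis, with probabilities proportional to $$\tau_{\lambda^{(N,N)}}(\rho_\circ)\prod_{e=(u\to v)\text{ vertical}}s_{\lambda^v/\lambda^u}(\rho_e)\prod_{e=(u\to v)\text{ horizontal}}s_{\lambda^u/\lambda^v}(\rho_e).$$ **Half-space geometric last passage percolation.** Let $c$ and $a_1,a_2,\dots$ be positive real numbers with $a_pa_q<1$ for all $p>q\ge1$ and $c\,a_p<1$ for all $p\ge1$. Let $(g_{p,q})_{p\ge q\ge1}$ be independent random variables with $\mathbb P(g_{p,q}=k)=(1-a_pa_q)(a_pa_q)^k$ for $p>q$ and $\mathbb P(g_{p,p}=k)=(1-ca_p)(ca_p)^k$,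 $k\in\mathbb Z_{\ge0}$. Define $G(p,0)=0$ and, for $p\ge q\ge1$, $G(p,q)=g_{p,q}+\max\{G(p-1,q),G(p,q-1)\}$ if $p>q$ and $G(p,p)=g_{p,p}+G(p,p-1)$. **Proposition.** Let $n\ge1$ and let $0<i_1<\dots<i_n$ and $j_1>\dots>j_n\ge0$ be integers with $i_k\ge j_k$ for all $k$. (a) The normalisation below is positive and finite, and $$\big(G(i_1,j_1),\dots,G(i_n,j_n)\big)\overset{(d)}{=}\big(\lambda^{(1)}_1,\dots,\lambda^{(n)}_1\big),$$ where $(\lambda^{(1)},\dots,\lambda^{(n)})$ is the $\lambda$-marginal of $\mathbf{PSP}[\rho_0^+;\dots;\rho_{n-1}^+\,|\,\rho_1^-;\dots;\rho_n^-]$ with $\rho_0^+=(c,a_{j_1+1},\dots,a_{i_1})$; $\rho_k^+=(a_{i_k+1},\dots,a_{i_{k+1}})$ and $\rho_k^-=(a_{j_{k+1}+1},\dots,a_{j_k})$ for $1\le k\le n-1$; and $\rho_n^-=(a_1,\dots,a_{j_n})$. (b) For every path $\gamma\in\Omega$ passing through $(i_1,j_1),\dots,(i_n,j_n)$, the Pfaffian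 Schur process indexed by $\gamma$, in which each vertical edge $(p,q-1)\to(p,q)$ is labelled by the single variable $a_q$, each horizontal edge $(p,q)\to(p-1,q)$ by the single variable $a_p$, and the diagonal edge by the single variable $c$, is well defined (positive finite normalisation), and $$\big(G(i_1,j_1),\dots,G(i_n,j_n)\big)\overset{(d)}{=}\big(\lambda^{(i_1,j_1)}_1,\dots,\lambda^{(i_n,j_n)}_1\big).$$ -/

import Mathlib

open MeasureTheory ProbabilityTheory
open scoped ENNReal NNReal

/-- Partitions are Young diagrams: `l.rowLen r` is the part `λ_{r+1}`, `≤` is containment, `⊥` is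
the empty partition, `l.card` is the number of boxes `|λ|`, `l.transpose` is the dual `λ'`. -/
instance : MeasurableSpace YoungDiagram := ⊤

/-- A partition is even if all its parts are even. -/
def YoungDiagram.IsEven (l : YoungDiagram) : Prop := ∀ r, Even (l.rowLen r)

/-- `m ≺ l`: `λ_r ≥ μ_r ≥ λ_{r+1}` for all `r`, that is, `λ / μ` is a horizontal strip. -/
def YoungDiagram.Interlaces (m l : YoungDiagram) : Prop :=
  ∀ r, m.rowLen r ≤ l.rowLen r ∧ l.rowLen (r + 1) ≤ m.rowLen r

/-- A (semistandard, or column-strict) skew tableau of shape `l / m` with entries in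
`{1, …, k}`, given by its increasing sequence of shapes
`m = λ⁽⁰⁾ ≺ λ⁽¹⁾ ≺ ⋯ ≺ λ⁽ᵏ⁾ = l`; the entries equal to `r` fill the horizontal strip
`λ⁽ʳ⁾ / λ⁽ʳ⁻¹⁾`. -/
structure SkewTableau (k : ℕ) (l m : YoungDiagram) where
  shape : Fin (k + 1) → YoungDiagram
  shape_zero : shape 0 = m
  shape_last : shape (Fin.last k) = l
  interlaces : ∀ r : Fin k, (shape r.castSucc).Interlaces (shape r.succ)

/-- The skew Schur function `s_{l / m}(x₁, …, x_k) = ∑_T x^T`, the sum being over the skew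
tableaux `T` of shape `l / m`, evaluated at finitely many nonnegative variables. It vanishes unless
`m ⊆ l`, and is the indicator of `l = m` for the empty list of variables. -/
noncomputable def skewSchur (x : List ℝ≥0) (l m : YoungDiagram) : ℝ≥0∞ :=
  ∑' T : SkewTableau x.length l m,
    ∏ r : Fin x.length,
      ((x.get r : ℝ≥0) : ℝ≥0∞) ^ ((T.shape r.succ).card - (T.shape r.castSucc).card)

/-- `τ_l = ∑_{κ' even} s_{l / κ}`. -/
noncomputable def tauSchur (x : List ℝ≥0) (l : YoungDiagram) : ℝ≥0∞ :=
  ∑' κ : {κ : YoungDiagram // κ.transpose.IsEven}, skewSchur x l κ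

/-- The measure giving mass `w x / ∑_y w y` to each point `x`. -/
noncomputable def normalizedMeasure {X : Type*} [MeasurableSpace X] (w : X → ℝ≥0∞) :
    Measure X :=
  (∑' x, w x)⁻¹ • Measure.sum (fun x => w x • Measure.dirac x)

/-- The weight of the sequence `∅ ⊆ λ⁽¹⁾ ⊇ μ⁽¹⁾ ⊆ λ⁽²⁾ ⊇ ⋯ ⊇ μ⁽ⁿ⁾ ⊆ λ⁽ⁿ⁺¹⁾ ⊇ ∅`. Here
`ρp = (ρ⁺_0, …, ρ⁺_n)`, `ρm = (ρ⁻_1, …, ρ⁻_{n+1})`, `lam = (λ⁽¹⁾, …, λ⁽ⁿ⁺¹⁾)`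
and `mu = (μ⁽¹⁾, …, μ⁽ⁿ⁾)`. -/
noncomputable def pfaffianSchurWeight {n : ℕ} (ρp ρm : Fin (n + 1) → List ℝ≥0)
    (s : (Fin (n + 1) → YoungDiagram) × (Fin n → YoungDiagram)) : ℝ≥0∞ :=
  tauSchur (ρp 0) (s.1 0) *
    (∏ k : Fin n, skewSchur (ρm k.castSucc) (s.1 k.castSucc) (s.2 k) *
      skewSchur (ρp k.succ) (s.1 k.succ) (s.2 k)) *
    skewSchur (ρm (Fin.last n)) (s.1 (Fin.last n)) ⊥

/-- The Pfaffian Schur process `PSP[ρ⁺_0; …; ρ⁺_n | ρ⁻_1; …; ρ⁻_{n+1}]`, as the law of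
`(λ, μ)`. -/
noncomputable def pfaffianSchurLaw {n : ℕ} (ρp ρm : Fin (n + 1) → List ℝ≥0) :
    Measure ((Fin (n + 1) → YoungDiagram) × (Fin n → YoungDiagram)) :=
  normalizedMeasure (pfaffianSchurWeight ρp ρm)

/-- A zig-zag path in the half-quadrant: it starts on the horizontal axis, proceeds by unit steps
to the left or upwards, and hits the diagonal at `(size, size)`, from where it takes one final edge
to the origin. The part of the path on the axis to the right of `vertex 0`, and the origin,
carry empty partitions only and are left implicit. -/
structure ZigZagPath where
  len : ℕ
  vertex : Fin (len + 1) → ℕ × ℕ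
  size : ℕ
  size_pos : 0 < size
  start : (vertex 0).2 = 0
  finish : vertex (Fin.last len) = (size, size)
  step : ∀ t : Fin len,
    ((vertex t.castSucc).1 = (vertex t.succ).1 + 1 ∧ (vertex t.castSucc).2 = (vertex t.succ).2) ∨
    ((vertex t.succ).1 = (vertex t.castSucc).1 ∧ (vertex t.succ).2 = (vertex t.castSucc).2 + 1)

namespace ZigZagPath

/-- The edge `vertex t → vertex (t + 1)` is vertical (otherwise it is horizontal). -/
abbrev IsUp (γ : ZigZagPath) (t : Fin γ.len) : Prop :=
  (γ.vertex t.succ).2 = (γ.vertex t.castSucc).2 + 1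

/-- The weight of the edge `u → v`: `s_{λ^v / λ^u}` for a vertical edge and `s_{λ^u / λ^v}` for
a horizontal edge. -/
noncomputable def edgeWeight (γ : ZigZagPath) (ρ : Fin γ.len → List ℝ≥0)
    (lam : Fin (γ.len + 1) → YoungDiagram) (t : Fin γ.len) : ℝ≥0∞ :=
  if γ.IsUp t then skewSchur (ρ t) (lam t.succ) (lam t.castSucc)
  else skewSchur (ρ t) (lam t.castSucc) (lam t.succ)

open Classical in
/-- The weight of a family of partitions indexed by the vertices of the path; the partitions on
the horizontal axis have to be empty. `ρ₀` labels the diagonal edge. -/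
noncomputable def weight (γ : ZigZagPath) (ρ₀ : List ℝ≥0) (ρ : Fin γ.len → List ℝ≥0)
    (lam : Fin (γ.len + 1) → YoungDiagram) : ℝ≥0∞ :=
  if ∀ t, (γ.vertex t).2 = 0 → lam t = ⊥ then
    tauSchur ρ₀ (lam (Fin.last γ.len)) * ∏ t : Fin γ.len, γ.edgeWeight ρ lam t
  else 0

/-- The Pfaffian Schur process indexed by a zig-zag path with labelled edges. -/
noncomputable def pfaffianSchurLaw (γ : ZigZagPath) (ρ₀ : List ℝ≥0)
    (ρ : Fin γ.len → List ℝ≥0) : Measure (Fin (γ.len + 1) → YoungDiagram) :=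
  normalizedMeasure (γ.weight ρ₀ ρ)

/-- The labels by single variables: the vertical edge `(p, q - 1) → (p, q)` is labelled by `a q`,
the horizontal edge `(p, q) → (p - 1, q)` by `a p`. -/
def label (γ : ZigZagPath) (a : ℕ → ℝ≥0) (t : Fin γ.len) : List ℝ≥0 :=
  if γ.IsUp t then [a (γ.vertex t.succ).2] else [a (γ.vertex t.castSucc).1]

end ZigZagPath

/-- The list of variables `(a_{p+1}, …, a_q)`, empty if `q ≤ p`. -/
def varsIoc (a : ℕ → ℝ≥0) (p q : ℕ) : List ℝ≥0 := (List.Ico (p + 1) (q + 1)).map a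

/-- `ρ⁺_0 = (c, a_{j₁+1}, …, a_{i₁})` and `ρ⁺_k = (a_{i_k+1}, …, a_{i_{k+1}})`; the indices
of `i` and `j` are shifted down by one. -/
def lppRhoPlus (a : ℕ → ℝ≥0) (c : ℝ≥0) {n : ℕ} (i j : Fin (n + 1) → ℕ) :
    Fin (n + 1) → List ℝ≥0 :=
  Fin.cons (α := fun _ => List ℝ≥0) (c :: varsIoc a (j 0) (i 0))
    (fun k : Fin n => varsIoc a (i k.castSucc) (i k.succ))

/-- `ρ⁻_k = (a_{j_{k+1}+1}, …, a_{j_k})`, and the last one is `(a_1, …, a_{j_{n+1}})`. -/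
def lppRhoMinus (a : ℕ → ℝ≥0) {n : ℕ} (j : Fin (n + 1) → ℕ) : Fin (n + 1) → List ℝ≥0 :=
  Fin.snoc (α := fun _ => List ℝ≥0)
    (fun k : Fin n => varsIoc a (j k.succ) (j k.castSucc))
    (varsIoc a 0 (j (Fin.last n)))

/-- `X ∼ Geom(q)` under `P`, that is, `P(X = k) = (1 - q) q^k` for `k = 0, 1, 2, …`. -/
def IsGeometric {Ω : Type*} [MeasurableSpace Ω] (P : Measure Ω) (X : Ω → ℕ) (q : ℝ) : Prop :=
  Measurable X ∧ ∀ k : ℕ, P (X ⁻¹' {k}) = ENNReal.ofReal ((1 - q) * q ^ k)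

/-- Half-space last passage times `G(n, m)`, `n ≥ m ≥ 0`, with weights `g n m`, `n ≥ m ≥ 1`
(the values for `n < m` are irrelevant). -/
def lastPassage (g : ℕ → ℕ → ℕ) : ℕ → ℕ → ℕ
  | _, 0 => 0
  | 0, _ + 1 => 0
  | n + 1, m + 1 =>
    g (n + 1) (m + 1) +
      if m + 1 ≤ n then max (lastPassage g n (m + 1)) (lastPassage g (n + 1) m)
      else lastPassage g (n + 1) m
  termination_by n m => n + m

/-!
Adding a box `(p, q)` at a corner of a zig-zag path replaces the partition `ν` at the corner by a
partition `κ`; the neighbours `λ`, `μ` on the path do not change. For a single variable on each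
edge the skew Cauchy identity `∑_κ s_{κ/λ}(x) s_{κ/μ}(y) = (1 - xy)⁻¹ ∑_ν s_{μ/ν}(x) s_{λ/ν}(y)`
has a bijective proof: a local growth rule `(ν, k) ↦ κ`, `k ≥ 0`, which reflects every row of `ν`
in the interval allowed by `λ` and `μ` and for which `κ_1 = max (λ_1, μ_1) + k`. Hence, given the
rest of the family, the new first row is the maximum of its neighbours plus an independent geometric
variable: this is the recursion for `G(p, q)`. At the diagonal the same happens with `τ` in place of
one Schur function, and `κ_1 = λ_1 + k` for the only neighbour `λ`.

So the equality in law of the first rows along the path and the last passage times is preserved by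
adding boxes. It is trivial for the path along the axis, all of whose partitions are empty. This
proves (b).

For (a), take a path with outer corners at the points `(i_k, j_k)` and sum over all the other
partitions: the branching rule merges the single variables along each straight run into the lists
`ρ⁺_k`, `ρ⁻_k`, and `μ⁽ᵏ⁾` sits at the inner corner between `λ⁽ᵏ⁾` and `λ⁽ᵏ⁺¹⁾`.
-/

section YoungDiagrams

variable {l m ν κ : YoungDiagram} {N r : ℕ}

theorem ext_rowLen (h : ∀ r, l.rowLen r = m.rowLen r) : l = m := by
  refine SetLike.ext fun ⟨i, j⟩ => ?_
  rw [YoungDiagram.mem_iff_lt_rowLen, YoungDiagram.mem_iff_lt_rowLen, h]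

theorem rowLen_eq_zero_of_le (h : l.rowLen N = 0) (hr : N ≤ r) : l.rowLen r = 0 :=
  Nat.eq_zero_of_le_zero (h ▸ l.rowLen_anti N r hr)

theorem rowLen_eq_zero_iff_colLen_zero_le : l.rowLen N = 0 ↔ l.colLen 0 ≤ N := by
  rw [← not_lt, ← YoungDiagram.mem_iff_lt_colLen, YoungDiagram.mem_iff_lt_rowLen, not_lt,
    Nat.le_zero]

theorem exists_rowLen_eq_zero (l m : YoungDiagram) : ∃ N, l.rowLen N = 0 ∧ m.rowLen N = 0 :=
  ⟨max (l.colLen 0) (m.colLen 0), rowLen_eq_zero_iff_colLen_zero_le.2 (le_max_left _ _),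
    rowLen_eq_zero_iff_colLen_zero_le.2 (le_max_right _ _)⟩

theorem rowLen_bot (r : ℕ) : (⊥ : YoungDiagram).rowLen r = 0 :=
  Nat.eq_zero_of_not_pos fun h =>
    YoungDiagram.notMem_bot _ (YoungDiagram.mem_iff_lt_rowLen.2 h)

theorem card_eq_sum_rowLen (h : l.rowLen N = 0) :
    l.card = ∑ r ∈ Finset.range N, l.rowLen r := by
  rw [YoungDiagram.card, Finset.card_eq_sum_card_fiberwise (f := Prod.fst) (t := Finset.range N)]
  · exact Finset.sum_congr rfl fun r _ => l.rowLen_eq_card.symm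
  · rintro ⟨i, j⟩ hc
    have hj : j < l.rowLen i := YoungDiagram.mem_iff_lt_rowLen.1 ((YoungDiagram.mem_cells _).1 hc)
    refine Finset.mem_coe.2 (Finset.mem_range.2 (lt_of_not_ge fun hi => ?_))
    exact absurd (rowLen_eq_zero_of_le h hi) (Nat.ne_zero_of_lt hj)

/-- The Young diagram with row lengths `f 0, …, f (N - 1)`, meant for antitone `f` with `f N = 0`.
For other `f` it is the largest diagram with `N` rows contained in the subgraph of `f`. -/
def diagramOfRows (f : ℕ → ℕ) (N : ℕ) : YoungDiagram where
  cells := (Finset.range N ×ˢ Finset.range (f 0)).filter fun c => ∀ i ≤ c.1, c.2 < f i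
  isLowerSet := by
    rintro ⟨i, j⟩ ⟨i', j'⟩ ⟨hi : i' ≤ i, hj : j' ≤ j⟩ h
    simp only [Finset.coe_filter, Finset.mem_product, Finset.mem_range, Set.mem_ofPred_eq] at h ⊢
    exact ⟨⟨hi.trans_lt h.1.1, hj.trans_lt h.1.2⟩,
      fun s hs => hj.trans_lt (h.2 s (hs.trans hi))⟩

theorem rowLen_diagramOfRows {f : ℕ → ℕ} (hf : Antitone f) (hN : f N = 0) (r : ℕ) :
    (diagramOfRows f N).rowLen r = f r := by
  refine eq_of_forall_lt_iff fun j => ?_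
  rw [← YoungDiagram.mem_iff_lt_rowLen, ← YoungDiagram.mem_cells]
  simp only [diagramOfRows, Finset.mem_filter, Finset.mem_product, Finset.mem_range]
  refine ⟨fun h => h.2 r le_rfl, fun h => ⟨⟨?_, h.trans_le (hf r.zero_le)⟩,
    fun s hs => h.trans_le (hf hs)⟩⟩
  by_contra! hr
  have := hf hr
  omega

theorem card_le_of_interlaces (h : m.Interlaces l) : m.card ≤ l.card := by
  obtain ⟨N, hl, hm⟩ := exists_rowLen_eq_zero l m
  rw [card_eq_sum_rowLen hl, card_eq_sum_rowLen hm]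
  exact Finset.sum_le_sum fun r _ => (h r).1

theorem interlaces_refl (l : YoungDiagram) : l.Interlaces l :=
  fun r => ⟨le_rfl, l.rowLen_anti _ _ r.le_succ⟩

theorem interlaces_bot_iff : m.Interlaces ⊥ ↔ m = ⊥ := by
  refine ⟨fun h => ext_rowLen fun r => ?_, fun h => h ▸ interlaces_refl m⟩
  exact le_antisymm (h r).1 (by simp only [rowLen_bot, zero_le])

/-- The row lengths of `growth l m ν k`. -/
def growthRow (l m ν : YoungDiagram) (k : ℕ) : ℕ → ℕ
  | 0 => max (l.rowLen 0) (m.rowLen 0) + k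
  | r + 1 => max (l.rowLen (r + 1)) (m.rowLen (r + 1)) + min (l.rowLen r) (m.rowLen r) - ν.rowLen r

/-- The local growth rule. Given `ν ≺ l` and `ν ≺ m`, it produces the diagram `κ` with `l ≺ κ` and
`m ≺ κ` whose first row exceeds those of `l` and `m` by `k`, and whose other rows are obtained by
reflecting each row `ν_r` in the interval `[max (l_{r+1}) (m_{r+1}), min (l_r) (m_r)]` in which
it is free to move. -/
def growth (l m ν : YoungDiagram) (k : ℕ) : YoungDiagram :=
  diagramOfRows (growthRow l m ν k) (max (l.colLen 0) (m.colLen 0) + 1)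

/-- The inverse of the local growth rule, which forgets the first row of `κ`. -/
def shrink (l m κ : YoungDiagram) : YoungDiagram :=
  diagramOfRows
    (fun r => max (l.rowLen (r + 1)) (m.rowLen (r + 1)) + min (l.rowLen r) (m.rowLen r)
      - κ.rowLen (r + 1))
    (max (l.colLen 0) (m.colLen 0))

theorem growthRow_antitone (hl : ν.Interlaces l) (hm : ν.Interlaces m) (k : ℕ) :
    Antitone (growthRow l m ν k) := by
  refine antitone_nat_of_succ_le fun r => ?_
  cases r with
  | zero =>
    have := hl 0; have := hm 0
    simp only [growthRow]
    omega
  | succ r =>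
    have := hl r; have := hm r; have := hl (r + 1); have := hm (r + 1)
    simp only [growthRow]
    omega

theorem rowLen_growth (hl : ν.Interlaces l) (hm : ν.Interlaces m) (k r : ℕ) :
    (growth l m ν k).rowLen r = growthRow l m ν k r := by
  refine rowLen_diagramOfRows (growthRow_antitone hl hm k) ?_ r
  have h : ∀ s ≥ max (l.colLen 0) (m.colLen 0), l.rowLen s = 0 ∧ m.rowLen s = 0 := fun s hs =>
    ⟨rowLen_eq_zero_iff_colLen_zero_le.2 ((le_max_left _ _).trans hs),
      rowLen_eq_zero_iff_colLen_zero_le.2 ((le_max_right _ _).trans hs)⟩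
  have h₀ := h _ le_rfl
  have h₁ := h _ (Nat.le_add_right _ 1)
  simp only [growthRow]
  omega

theorem rowLen_zero_growth (hl : ν.Interlaces l) (hm : ν.Interlaces m) (k : ℕ) :
    (growth l m ν k).rowLen 0 = max (l.rowLen 0) (m.rowLen 0) + k :=
  rowLen_growth hl hm k 0

theorem rowLen_succ_growth (hl : ν.Interlaces l) (hm : ν.Interlaces m) (k r : ℕ) :
    (growth l m ν k).rowLen (r + 1) =
      max (l.rowLen (r + 1)) (m.rowLen (r + 1)) + min (l.rowLen r) (m.rowLen r) - ν.rowLen r :=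
  rowLen_growth hl hm k (r + 1)

theorem rowLen_shrink (hl : l.Interlaces κ) (hm : m.Interlaces κ) (r : ℕ) :
    (shrink l m κ).rowLen r =
      max (l.rowLen (r + 1)) (m.rowLen (r + 1)) + min (l.rowLen r) (m.rowLen r)
        - κ.rowLen (r + 1) := by
  refine rowLen_diagramOfRows (antitone_nat_of_succ_le fun r => ?_) ?_ r
  · have := hl r; have := hm r; have := hl (r + 1); have := hm (r + 1)
    have := hl (r + 1 + 1); have := hm (r + 1 + 1)
    omega
  · have hl₀ : l.rowLen (max (l.colLen 0) (m.colLen 0)) = 0 :=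
      rowLen_eq_zero_iff_colLen_zero_le.2 (le_max_left _ _)
    have hm₀ : m.rowLen (max (l.colLen 0) (m.colLen 0)) = 0 :=
      rowLen_eq_zero_iff_colLen_zero_le.2 (le_max_right _ _)
    have := rowLen_eq_zero_of_le hl₀ (Nat.le_add_right _ 1)
    have := rowLen_eq_zero_of_le hm₀ (Nat.le_add_right _ 1)
    omega

theorem interlaces_growth (hl : ν.Interlaces l) (hm : ν.Interlaces m) (k : ℕ) :
    l.Interlaces (growth l m ν k) ∧ m.Interlaces (growth l m ν k) := by
  have between (r : ℕ) : max (l.rowLen r) (m.rowLen r) ≤ (growth l m ν k).rowLen r ∧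
      (growth l m ν k).rowLen (r + 1) ≤ min (l.rowLen r) (m.rowLen r) := by
    have := hl r; have := hm r
    rw [rowLen_succ_growth hl hm]
    cases r with
    | zero => rw [rowLen_zero_growth hl hm]; omega
    | succ r =>
      have := hl r; have := hm r
      rw [rowLen_succ_growth hl hm]; omega
  constructor <;> intro r <;> have := between r <;> omega

theorem interlaces_shrink (hl : l.Interlaces κ) (hm : m.Interlaces κ) :
    (shrink l m κ).Interlaces l ∧ (shrink l m κ).Interlaces m := by
  have between (r : ℕ) : (shrink l m κ).rowLen r ≤ min (l.rowLen r) (m.rowLen r) ∧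
      max (l.rowLen (r + 1)) (m.rowLen (r + 1)) ≤ (shrink l m κ).rowLen r := by
    have := hl r; have := hm r; have := hl (r + 1); have := hm (r + 1)
    rw [rowLen_shrink hl hm]; omega
  constructor <;> intro r <;> have := between r <;> omega

/-- The local growth rule as a bijection: a diagram above `l` and `m` is a diagram below `l` and
`m` together with the amount by which its first row exceeds those of `l` and `m`. -/
def growthEquiv (l m : YoungDiagram) :
    ℕ × {ν : YoungDiagram // ν.Interlaces l ∧ ν.Interlaces m} ≃
      {κ : YoungDiagram // l.Interlaces κ ∧ m.Interlaces κ} where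
  toFun p := ⟨growth l m p.2.1 p.1, interlaces_growth p.2.2.1 p.2.2.2 p.1⟩
  invFun κ := (κ.1.rowLen 0 - max (l.rowLen 0) (m.rowLen 0),
    ⟨shrink l m κ.1, interlaces_shrink κ.2.1 κ.2.2⟩)
  left_inv := by
    rintro ⟨k, ν, hl, hm⟩
    have hl' := (interlaces_growth hl hm k).1
    have hm' := (interlaces_growth hl hm k).2
    refine Prod.ext ?_ (Subtype.ext (ext_rowLen fun r => ?_))
    · simp only [rowLen_zero_growth hl hm]; omega
    · have := hl r; have := hm r
      simp only [rowLen_shrink hl' hm', rowLen_succ_growth hl hm]; omega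
  right_inv := by
    rintro ⟨κ, hl, hm⟩
    have hs := interlaces_shrink hl hm
    refine Subtype.ext (ext_rowLen fun r => ?_)
    cases r with
    | zero =>
      have := hl 0; have := hm 0
      simp only [rowLen_zero_growth hs.1 hs.2]; omega
    | succ r =>
      have := hl r; have := hm r; have := hl (r + 1); have := hm (r + 1)
      simp only [rowLen_succ_growth hs.1 hs.2, rowLen_shrink hl hm]; omega

theorem rowLen_succ_growth_eq_zero (hl : ν.Interlaces l) (hm : ν.Interlaces m) (k : ℕ)
    (hN : l.rowLen N = 0) : (growth l m ν k).rowLen (N + 1) = 0 := by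
  have := ((interlaces_growth hl hm k).1 N).2
  omega

theorem card_growth (hl : ν.Interlaces l) (hm : ν.Interlaces m) (k : ℕ) :
    (growth l m ν k).card + ν.card = k + l.card + m.card := by
  obtain ⟨N, hlN, hmN⟩ := exists_rowLen_eq_zero l m
  have hνN : ν.rowLen N = 0 := Nat.eq_zero_of_le_zero (hlN ▸ (hl N).1)
  have partial_sums (n : ℕ) : ∑ r ∈ Finset.range (n + 1), (growth l m ν k).rowLen r +
      ∑ r ∈ Finset.range n, ν.rowLen r =
      k + ∑ r ∈ Finset.range n, l.rowLen r + ∑ r ∈ Finset.range n, m.rowLen r +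
        max (l.rowLen n) (m.rowLen n) := by
    induction n with
    | zero => simp [rowLen_zero_growth hl hm]; omega
    | succ n ih =>
      rw [Finset.sum_range_succ _ (n + 1), rowLen_succ_growth hl hm]
      simp only [Finset.sum_range_succ _ n] at ih ⊢
      have := hl n; have := hm n
      omega
  rw [card_eq_sum_rowLen (rowLen_succ_growth_eq_zero hl hm k hlN), card_eq_sum_rowLen hνN,
    card_eq_sum_rowLen hlN, card_eq_sum_rowLen hmN, partial_sums, hlN, hmN, max_self, add_zero]

theorem isEven_transpose_iff (l : YoungDiagram) :
    l.transpose.IsEven ↔ ∀ s, l.rowLen (2 * s) = l.rowLen (2 * s + 1) := by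
  simp only [YoungDiagram.IsEven, YoungDiagram.rowLen_transpose]
  have lt_iff (i j : ℕ) : i < l.colLen j ↔ j < l.rowLen i := by
    rw [← YoungDiagram.mem_iff_lt_colLen, YoungDiagram.mem_iff_lt_rowLen]
  constructor
  · intro h s
    refine le_antisymm (le_of_not_gt fun hlt => ?_) (l.rowLen_anti _ _ (Nat.le_succ _))
    have := (lt_iff (2 * s) (l.rowLen (2 * s + 1))).2 hlt
    have := mt (lt_iff (2 * s + 1) (l.rowLen (2 * s + 1))).1 (lt_irrefl _)
    obtain ⟨t, ht⟩ := h (l.rowLen (2 * s + 1))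
    omega
  · intro h j
    by_contra hodd
    obtain ⟨s, hs⟩ := Nat.not_even_iff_odd.1 hodd
    have := (lt_iff (2 * s) j).1 (by omega)
    have := mt (lt_iff (2 * s + 1) j).2 (by omega)
    have := h s
    omega

/-- The unique diagram `κ ≺ l` with columns of even length: each column of odd length loses its
lowest box. -/
def evenCore (l : YoungDiagram) : YoungDiagram :=
  diagramOfRows (fun r => l.rowLen (2 * (r / 2) + 1)) (l.colLen 0)

theorem rowLen_evenCore (l : YoungDiagram) (r : ℕ) :
    (evenCore l).rowLen r = l.rowLen (2 * (r / 2) + 1) :=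
  rowLen_diagramOfRows (fun _ _ _ => l.rowLen_anti _ _ (by omega))
    (rowLen_eq_zero_iff_colLen_zero_le.2 (by omega)) r

theorem rowLen_two_mul_evenCore (l : YoungDiagram) (s : ℕ) :
    (evenCore l).rowLen (2 * s) = l.rowLen (2 * s + 1) := by
  rw [rowLen_evenCore, Nat.mul_div_cancel_left s two_pos]

theorem rowLen_two_mul_add_one_evenCore (l : YoungDiagram) (s : ℕ) :
    (evenCore l).rowLen (2 * s + 1) = l.rowLen (2 * s + 1) := by
  rw [rowLen_evenCore, show (2 * s + 1) / 2 = s by omega]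

theorem isEven_transpose_evenCore (l : YoungDiagram) : (evenCore l).transpose.IsEven :=
  (isEven_transpose_iff _).2 fun s => by
    rw [rowLen_two_mul_evenCore, rowLen_two_mul_add_one_evenCore]

theorem evenCore_interlaces (l : YoungDiagram) : (evenCore l).Interlaces l := by
  intro r
  rcases Nat.even_or_odd' r with ⟨s, rfl | rfl⟩
  · rw [rowLen_two_mul_evenCore]
    exact ⟨l.rowLen_anti _ _ (Nat.le_succ _), le_rfl⟩
  · rw [rowLen_two_mul_add_one_evenCore]
    exact ⟨le_rfl, l.rowLen_anti _ _ (Nat.le_succ _)⟩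

theorem eq_evenCore (hκ : κ.transpose.IsEven) (h : κ.Interlaces l) : κ = evenCore l := by
  rw [isEven_transpose_iff] at hκ
  refine ext_rowLen fun r => ?_
  rcases Nat.even_or_odd' r with ⟨s, rfl | rfl⟩
  · have := h (2 * s); have := h (2 * s + 1); have := hκ s
    rw [rowLen_two_mul_evenCore]; omega
  · have := h (2 * s); have := h (2 * s + 1); have := hκ s
    rw [rowLen_two_mul_add_one_evenCore]; omega

/-- The number of columns of odd length, which is the alternating sum `l₁ - l₂ + l₃ - ⋯`. -/
def oddColumns (l : YoungDiagram) : ℕ :=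
  ∑ s ∈ Finset.range (l.colLen 0), (l.rowLen (2 * s) - l.rowLen (2 * s + 1))

theorem oddColumns_eq_sum (h : l.rowLen (2 * N) = 0) :
    oddColumns l = ∑ s ∈ Finset.range N, (l.rowLen (2 * s) - l.rowLen (2 * s + 1)) := by
  have vanish {s : ℕ} (hs : s ∉ Finset.range (min (l.colLen 0) N)) :
      l.rowLen (2 * s) - l.rowLen (2 * s + 1) = 0 := by
    have := rowLen_eq_zero_iff_colLen_zero_le.1 h
    rw [Finset.mem_range, not_lt] at hs
    rw [rowLen_eq_zero_iff_colLen_zero_le.2 (show l.colLen 0 ≤ 2 * s by omega), Nat.zero_sub]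
  rw [oddColumns, ← Finset.sum_subset (Finset.range_mono (min_le_left (l.colLen 0) N))
    fun s _ hs => vanish hs]
  exact Finset.sum_subset (Finset.range_mono (min_le_right (l.colLen 0) N)) fun s _ hs => vanish hs

theorem card_evenCore_add_oddColumns (l : YoungDiagram) :
    (evenCore l).card + oddColumns l = l.card := by
  have hl : l.rowLen (2 * l.colLen 0) = 0 := rowLen_eq_zero_iff_colLen_zero_le.2 (by omega)
  have he : (evenCore l).rowLen (2 * l.colLen 0) = 0 :=
    Nat.eq_zero_of_le_zero ((evenCore_interlaces l _).1.trans hl.le)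
  rw [card_eq_sum_rowLen hl, card_eq_sum_rowLen he, oddColumns]
  induction l.colLen 0 with
  | zero => rfl
  | succ n ih =>
    have := l.rowLen_anti _ _ (Nat.le_succ (2 * n))
    simp only [show 2 * (n + 1) = 2 * n + 1 + 1 by ring, Finset.sum_range_succ,
      rowLen_two_mul_evenCore, rowLen_two_mul_add_one_evenCore, Nat.succ_eq_add_one] at ih ⊢ this
    omega

theorem oddColumns_growth (h : ν.Interlaces m) (k : ℕ) :
    oddColumns (growth m m ν k) = k + oddColumns ν := by
  have hm : m.rowLen (2 * m.colLen 0 + 1) = 0 := rowLen_eq_zero_iff_colLen_zero_le.2 (by omega)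
  have hν : ν.rowLen (2 * m.colLen 0) = 0 :=
    Nat.eq_zero_of_le_zero ((h _).1.trans (rowLen_eq_zero_iff_colLen_zero_le.2 (by omega)).le)
  have hκ : (growth m m ν k).rowLen (2 * (m.colLen 0 + 1)) = 0 :=
    rowLen_succ_growth_eq_zero h h k hm
  rw [oddColumns_eq_sum hκ, oddColumns_eq_sum hν]
  have partial_sums (n : ℕ) :
      ∑ s ∈ Finset.range (n + 1),
        ((growth m m ν k).rowLen (2 * s) - (growth m m ν k).rowLen (2 * s + 1)) +
          m.rowLen (2 * n + 1) =
      k + ∑ s ∈ Finset.range n, (ν.rowLen (2 * s) - ν.rowLen (2 * s + 1)) + ν.rowLen (2 * n) := by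
    have h₀ := rowLen_zero_growth h h k
    have hs := rowLen_succ_growth h h k
    simp only [max_self, min_self] at h₀ hs
    induction n with
    | zero =>
      have := h 0; have := hs 0
      simp only [zero_add, Finset.range_one, Finset.sum_singleton, Finset.range_zero,
        Finset.sum_empty, mul_zero] at *
      omega
    | succ n ih =>
      have := h (2 * n); have := h (2 * n + 1); have := h (2 * n + 2)
      have := hs (2 * n); have := hs (2 * n + 1); have := hs (2 * n + 2)
      rw [Finset.sum_range_succ _ (n + 1)]
      simp only [Finset.sum_range_succ _ n, mul_add, mul_one, add_assoc, Nat.reduceAdd] at *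
      omega
  have := partial_sums (m.colLen 0)
  omega

end YoungDiagrams

namespace SkewTableau

variable {k : ℕ} {l m : YoungDiagram}

theorem ext_shape {S T : SkewTableau k l m} (h : S.shape = T.shape) : S = T := by
  cases S; cases T; congr

/-- A tableau is given by the shape `κ` of its entries equal to `1` and a tableau above `κ`. -/
def consEquiv (k : ℕ) (l m : YoungDiagram) :
    SkewTableau (k + 1) l m ≃ Σ κ : {κ : YoungDiagram // m.Interlaces κ}, SkewTableau k l κ where
  toFun T := ⟨⟨T.shape 1, (congrArg (·.Interlaces (T.shape 1)) T.shape_zero).mp (T.interlaces 0)⟩,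
    { shape := fun r => T.shape r.succ
      shape_zero := rfl
      shape_last := T.shape_last
      interlaces := fun r => T.interlaces r.succ }⟩
  invFun p :=
    { shape := Fin.cons m p.2.shape
      shape_zero := rfl
      shape_last := p.2.shape_last
      interlaces := Fin.cases ((congrArg m.Interlaces p.2.shape_zero).mpr p.1.2) p.2.interlaces }
  left_inv T := ext_shape (funext (Fin.cases T.shape_zero.symm fun _ => rfl))
  right_inv := by
    rintro ⟨⟨κ, hκ⟩, ⟨shape, h₀, h₁, h₂⟩⟩
    obtain rfl : shape 0 = κ := h₀
    rfl

end SkewTableau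

section SchurFunctions

variable {l m : YoungDiagram} {x : ℝ≥0}

open Classical in
theorem skewSchur_nil (l m : YoungDiagram) : skewSchur [] l m = if l = m then 1 else 0 := by
  rw [skewSchur]
  split_ifs with h
  · subst h
    let T : SkewTableau ([] : List ℝ≥0).length l l := ⟨fun _ => l, rfl, rfl, fun r => r.elim0⟩
    have eq_T (S : SkewTableau ([] : List ℝ≥0).length l l) : S = T :=
      SkewTableau.ext_shape (funext fun r => Subsingleton.elim (α := Fin 1) 0 r ▸ S.shape_zero)
    rw [tsum_eq_single T fun S hS => absurd (eq_T S) hS]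
    exact Fin.prod_univ_zero _
  · have : IsEmpty (SkewTableau ([] : List ℝ≥0).length l m) :=
      ⟨fun T => h (T.shape_last.symm.trans T.shape_zero)⟩
    exact tsum_empty

theorem skewSchur_cons_eq_tsum_subtype (x : ℝ≥0) (xs : List ℝ≥0) (l m : YoungDiagram) :
    skewSchur (x :: xs) l m =
      ∑' κ : {κ : YoungDiagram // m.Interlaces κ},
        (x : ℝ≥0∞) ^ (κ.1.card - m.card) * skewSchur xs l κ := by
  refine ((SkewTableau.consEquiv xs.length l m).symm.tsum_eq _).symm.trans ?_
  rw [ENNReal.tsum_sigma']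
  refine tsum_congr fun κ => ?_
  rw [skewSchur, ← ENNReal.tsum_mul_left]
  refine tsum_congr fun T => (Fin.prod_univ_succ _).trans ?_
  congr 2
  exact congrArg (fun μ : YoungDiagram => μ.card - m.card) T.shape_zero

theorem interlaces_of_skewSchur_singleton_ne_zero (h : skewSchur [x] l m ≠ 0) :
    m.Interlaces l := by
  contrapose! h
  rw [skewSchur_cons_eq_tsum_subtype]
  refine ENNReal.tsum_eq_zero.2 fun ⟨κ, hκ⟩ => ?_
  rw [skewSchur_nil, if_neg (by rintro rfl; exact h hκ), mul_zero]

theorem skewSchur_singleton_of_interlaces (x : ℝ≥0) (h : m.Interlaces l) :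
    skewSchur [x] l m = (x : ℝ≥0∞) ^ (l.card - m.card) := by
  rw [skewSchur_cons_eq_tsum_subtype, tsum_eq_single ⟨l, h⟩]
  · rw [skewSchur_nil, if_pos rfl, mul_one]
  · rintro ⟨κ, hκ⟩ hne
    rw [skewSchur_nil, if_neg fun e => hne (Subtype.ext e.symm), mul_zero]

theorem skewSchur_cons (x : ℝ≥0) (xs : List ℝ≥0) (l m : YoungDiagram) :
    skewSchur (x :: xs) l m = ∑' κ, skewSchur [x] κ m * skewSchur xs l κ := by
  have hsupp : (Function.support fun κ => skewSchur [x] κ m * skewSchur xs l κ) ⊆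
      {κ | m.Interlaces κ} :=
    fun κ hκ => interlaces_of_skewSchur_singleton_ne_zero (left_ne_zero_of_mul hκ)
  rw [skewSchur_cons_eq_tsum_subtype, ← tsum_subtype_eq_of_support_subset hsupp]
  exact tsum_congr fun κ => by rw [skewSchur_singleton_of_interlaces x κ.2]

theorem tauSchur_cons (x : ℝ≥0) (xs : List ℝ≥0) (l : YoungDiagram) :
    tauSchur (x :: xs) l = ∑' κ, tauSchur [x] κ * skewSchur xs l κ := by
  simp only [tauSchur, skewSchur_cons x xs, ← ENNReal.tsum_mul_right]
  exact ENNReal.tsum_comm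

theorem tauSchur_singleton (x : ℝ≥0) (l : YoungDiagram) :
    tauSchur [x] l = (x : ℝ≥0∞) ^ oddColumns l := by
  rw [tauSchur, tsum_eq_single ⟨evenCore l, isEven_transpose_evenCore l⟩]
  · rw [skewSchur_singleton_of_interlaces x (evenCore_interlaces l),
      ← card_evenCore_add_oddColumns l, Nat.add_sub_cancel_left]
  · rintro ⟨κ, hκ⟩ hne
    by_contra h
    exact hne (Subtype.ext (eq_evenCore hκ (interlaces_of_skewSchur_singleton_ne_zero h)))

theorem tauSchur_singleton_bot (x : ℝ≥0) : tauSchur [x] ⊥ = 1 := by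
  simp [tauSchur_singleton, oddColumns, rowLen_bot]

theorem tsum_mul_of_growth {w w' : YoungDiagram → ℝ≥0∞} {q : ℝ≥0∞}
    (hw : ∀ κ, w κ ≠ 0 → l.Interlaces κ ∧ m.Interlaces κ)
    (hw' : ∀ ν, w' ν ≠ 0 → ν.Interlaces l ∧ ν.Interlaces m)
    (hgrowth : ∀ k ν, ν.Interlaces l → ν.Interlaces m → w (growth l m ν k) = q ^ k * w' ν)
    (φ : ℕ → ℝ≥0∞) :
    ∑' κ, φ (κ.rowLen 0) * w κ =
      (∑' k, φ (max (l.rowLen 0) (m.rowLen 0) + k) * q ^ k) * ∑' ν, w' ν := by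
  have hsupp : (Function.support fun κ => φ (κ.rowLen 0) * w κ) ⊆
      {κ | l.Interlaces κ ∧ m.Interlaces κ} := fun κ hκ => hw κ (right_ne_zero_of_mul hκ)
  have hsupp' : Function.support w' ⊆ {ν | ν.Interlaces l ∧ ν.Interlaces m} := hw'
  rw [← tsum_subtype_eq_of_support_subset hsupp, ← tsum_subtype_eq_of_support_subset hsupp']
  refine ((growthEquiv l m).tsum_eq fun κ => φ (κ.1.rowLen 0) * w κ.1).symm.trans ?_
  rw [ENNReal.tsum_prod', ← ENNReal.tsum_mul_right]
  refine tsum_congr fun k => ?_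
  rw [← ENNReal.tsum_mul_left]
  refine tsum_congr fun ν => ?_
  change φ ((growth l m ν k).rowLen 0) * w (growth l m ν k) = _
  rw [rowLen_zero_growth ν.2.1 ν.2.2, hgrowth k ν ν.2.1 ν.2.2, mul_assoc]

theorem tsum_mul_skewSchur_mul_skewSchur (x y : ℝ≥0) (l m : YoungDiagram) (φ : ℕ → ℝ≥0∞) :
    ∑' κ, φ (κ.rowLen 0) * (skewSchur [x] κ l * skewSchur [y] κ m) =
      (∑' k, φ (max (l.rowLen 0) (m.rowLen 0) + k) * ((x * y : ℝ≥0) : ℝ≥0∞) ^ k) *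
        ∑' ν, skewSchur [x] m ν * skewSchur [y] l ν := by
  refine tsum_mul_of_growth
    (fun κ h => ⟨interlaces_of_skewSchur_singleton_ne_zero (left_ne_zero_of_mul h),
      interlaces_of_skewSchur_singleton_ne_zero (right_ne_zero_of_mul h)⟩)
    (fun ν h => ⟨interlaces_of_skewSchur_singleton_ne_zero (right_ne_zero_of_mul h),
      interlaces_of_skewSchur_singleton_ne_zero (left_ne_zero_of_mul h)⟩)
    (fun k ν hl hm => ?_) φ
  have hκ := interlaces_growth hl hm k
  have hcard := card_growth hl hm k
  have := card_le_of_interlaces hl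
  have := card_le_of_interlaces hm
  rw [skewSchur_singleton_of_interlaces x hκ.1, skewSchur_singleton_of_interlaces y hκ.2,
    skewSchur_singleton_of_interlaces x hm, skewSchur_singleton_of_interlaces y hl,
    show (growth l m ν k).card - l.card = k + (m.card - ν.card) by omega,
    show (growth l m ν k).card - m.card = k + (l.card - ν.card) by omega, ENNReal.coe_mul]
  ring

theorem tsum_mul_tauSchur_mul_skewSchur (c x : ℝ≥0) (m : YoungDiagram) (φ : ℕ → ℝ≥0∞) :
    ∑' κ, φ (κ.rowLen 0) * (tauSchur [c] κ * skewSchur [x] κ m) =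
      (∑' k, φ (m.rowLen 0 + k) * ((c * x : ℝ≥0) : ℝ≥0∞) ^ k) *
        ∑' ν, tauSchur [c] ν * skewSchur [x] m ν := by
  have key := tsum_mul_of_growth (l := m) (m := m) (q := ((c * x : ℝ≥0) : ℝ≥0∞))
    (w := fun κ => tauSchur [c] κ * skewSchur [x] κ m)
    (w' := fun ν => tauSchur [c] ν * skewSchur [x] m ν)
    (fun κ h => and_self_iff.2 (interlaces_of_skewSchur_singleton_ne_zero (right_ne_zero_of_mul h)))
    (fun ν h => and_self_iff.2 (interlaces_of_skewSchur_singleton_ne_zero (right_ne_zero_of_mul h)))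
    (fun k ν hν _ => ?_) φ
  · simpa only [max_self] using key
  have hcard := card_growth hν hν k
  have := card_le_of_interlaces hν
  rw [skewSchur_singleton_of_interlaces x (interlaces_growth hν hν k).1,
    skewSchur_singleton_of_interlaces x hν, tauSchur_singleton, tauSchur_singleton,
    oddColumns_growth hν, ENNReal.coe_mul,
    show (growth m m ν k).card - m.card = k + (m.card - ν.card) by omega]
  ring

end SchurFunctions

section LastPassage

theorem lastPassage_zero_right (g : ℕ → ℕ → ℕ) (p : ℕ) : lastPassage g p 0 = 0 := by
  rw [lastPassage]

theorem lastPassage_succ_self (g : ℕ → ℕ → ℕ) (q : ℕ) :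
    lastPassage g (q + 1) (q + 1) = lastPassage g (q + 1) q + g (q + 1) (q + 1) := by
  rw [lastPassage, if_neg q.not_succ_le_self, add_comm]

theorem lastPassage_succ_succ (g : ℕ → ℕ → ℕ) {p q : ℕ} (h : q < p) :
    lastPassage g (p + 1) (q + 1) =
      max (lastPassage g p (q + 1)) (lastPassage g (p + 1) q) + g (p + 1) (q + 1) := by
  rw [lastPassage, if_pos (Nat.succ_le_of_lt h), add_comm]

variable {Ω : Type*} {g : ℕ → ℕ → Ω → ℕ} {p q : ℕ}

theorem measurable_lastPassage [MeasurableSpace Ω] (hqp : q ≤ p)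
    (hg : ∀ p' q', 1 ≤ q' → q' ≤ p' → p' ≤ p → q' ≤ q → Measurable (g p' q')) :
    Measurable fun ω => lastPassage (fun p q => g p q ω) p q := by
  induction p, q using lastPassage.induct with
  | case1 p => simp only [lastPassage_zero_right, measurable_const]
  | case2 q => omega
  | case3 p q ih_left ih_below =>
    have measurable_weight := hg _ _ q.succ_pos hqp le_rfl le_rfl
    have measurable_below (h : q ≤ p + 1) := ih_below h fun p' q' _ _ _ _ =>
      hg p' q' (by omega) (by omega) (by omega) (by omega)
    rcases (Nat.le_of_succ_le_succ hqp).eq_or_lt with rfl | h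
    · simp only [lastPassage_succ_self]
      exact (measurable_below (by omega)).add measurable_weight
    · simp only [lastPassage_succ_succ _ h]
      exact ((ih_left h fun p' q' _ _ _ _ =>
        hg p' q' (by omega) (by omega) (by omega) (by omega)).max
        (measurable_below (by omega))).add measurable_weight

theorem indepFun_lastPassage [MeasurableSpace Ω] {P : Measure Ω} {ι : Type*} {x y : ι → ℕ}
    (hg : ∀ p q, 1 ≤ q → q ≤ p → Measurable (g p q))
    (hindep : iIndepFun (fun v : {v : ℕ × ℕ // 1 ≤ v.2 ∧ v.2 ≤ v.1} => g v.1.1 v.1.2) P)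
    (hyx : ∀ s, y s ≤ x s) (hq : 1 ≤ q) (hqp : q ≤ p) (h : ∀ s, q ≤ y s → x s < p) :
    IndepFun (fun ω s => lastPassage (fun p q => g p q ω) (x s) (y s)) (g p q) P := by
  let v₀ : {v : ℕ × ℕ // 1 ≤ v.2 ∧ v.2 ≤ v.1} := ⟨(p, q), hq, hqp⟩
  have indep_compl := indep_iSup_of_disjoint
    (fun v : {v : ℕ × ℕ // 1 ≤ v.2 ∧ v.2 ≤ v.1} => (hg v.1.1 v.1.2 v.2.1 v.2.2).comap_le)
    hindep.iIndep (disjoint_compl_left (a := {v₀}))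
  refine (IndepFun_iff_Indep _ _ _).2 (indep_of_indep_of_le_left
    (indep_of_indep_of_le_right indep_compl ?_) (Measurable.comap_le ?_))
  · exact le_iSup₂_of_le v₀ rfl le_rfl
  · refine @measurable_pi_lambda _ _ _ (_) _ _ fun s =>
      @measurable_lastPassage _ _ _ _ (_) (hyx s) fun p' q' hq' hqp' hp hy => ?_
    refine (comap_measurable (g p' q')).mono
      (le_iSup₂_of_le ⟨(p', q'), hq', hqp'⟩ (fun heq => ?_) le_rfl) le_rfl
    obtain ⟨rfl, rfl⟩ := Prod.mk.inj (congrArg Subtype.val heq)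
    exact absurd (h s hy) hp.not_gt

end LastPassage

section GeometricWeights

variable {Ω : Type*} [MeasurableSpace Ω] {P : Measure Ω}

theorem lintegral_comp_isGeometric [IsFiniteMeasure P] {β : Type*} [MeasurableSpace β]
    {X : Ω → ℕ} {Y : Ω → β} {q : ℝ≥0} (hX : IsGeometric P X q) (hY : Measurable Y)
    (hindep : IndepFun X Y P) {F : ℕ → β → ℝ≥0∞} (hF : ∀ k, Measurable (F k)) :
    ∫⁻ ω, F (X ω) (Y ω) ∂P =
      ENNReal.ofReal (1 - q) * ∫⁻ ω, ∑' k, F k (Y ω) * (q : ℝ≥0∞) ^ k ∂P := by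
  have hF' : Measurable (Function.uncurry F) := measurable_from_prod_countable_right hF
  have hFY (k : ℕ) : Measurable fun ω => F k (Y ω) := (hF k).comp hY
  have hXk (k : ℕ) : P.map X {k} = ENNReal.ofReal (1 - q) * (q : ℝ≥0∞) ^ k := by
    rw [Measure.map_apply hX.1 (measurableSet_singleton k), hX.2,
      ENNReal.ofReal_mul' (by positivity), ENNReal.ofReal_pow q.coe_nonneg,
      ENNReal.ofReal_coe_nnreal]
  calc ∫⁻ ω, F (X ω) (Y ω) ∂P
    _ = ∫⁻ z, Function.uncurry F z ∂(P.map X).prod (P.map Y) := by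
      rw [← hindep.map_prod_eq_prod_map_map hX.1.aemeasurable hY.aemeasurable,
        lintegral_map hF' (hX.1.prodMk hY)]
      rfl
    _ = ∑' k, (∫⁻ y, F k y ∂P.map Y) * P.map X {k} := by
      rw [lintegral_prod _ hF'.aemeasurable, lintegral_countable']
      rfl
    _ = ∑' k, ENNReal.ofReal (1 - q) * ∫⁻ ω, F k (Y ω) * (q : ℝ≥0∞) ^ k ∂P := by
      refine tsum_congr fun k => ?_
      rw [lintegral_map (hF k) hY, hXk, lintegral_mul_const _ (hFY k)]
      ring
    _ = ENNReal.ofReal (1 - q) * ∫⁻ ω, ∑' k, F k (Y ω) * (q : ℝ≥0∞) ^ k ∂P := by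
      rw [ENNReal.tsum_mul_left,
        lintegral_tsum fun k => ((hFY k).mul_const _).aemeasurable]

/-- The random environment of half-space geometric last passage percolation: independent geometric
weights `g p q`, `p ≥ q ≥ 1`, with parameters `a p * a q < 1` off the diagonal and `c * a p < 1`
on it. -/
structure IsGeometricEnvironment (P : Measure Ω) (a : ℕ → ℝ≥0) (c : ℝ≥0) (g : ℕ → ℕ → Ω → ℕ) :
    Prop where
  mul_lt_one : ∀ p q, 1 ≤ q → q < p → a p * a q < 1
  diag_lt_one : ∀ p, 1 ≤ p → c * a p < 1
  isGeometric : ∀ p q, 1 ≤ q → q < p → IsGeometric P (g p q) (a p * a q)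
  isGeometric_diag : ∀ p, 1 ≤ p → IsGeometric P (g p p) (c * a p)
  iIndepFun : iIndepFun (fun v : {v : ℕ × ℕ // 1 ≤ v.2 ∧ v.2 ≤ v.1} => g v.1.1 v.1.2) P

theorem IsGeometricEnvironment.measurable {a : ℕ → ℝ≥0} {c : ℝ≥0} {g : ℕ → ℕ → Ω → ℕ}
    (hg : IsGeometricEnvironment P a c g) (p q : ℕ) (hq : 1 ≤ q) (hqp : q ≤ p) :
    Measurable (g p q) := by
  rcases hqp.eq_or_lt with rfl | h
  · exact (hg.isGeometric_diag q hq).1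
  · exact (hg.isGeometric p q hq h).1

end GeometricWeights

section ProportionalLaws

/-- The push-forward under `R` of the measure on `X` with weights `w` is a positive finite multiple
of the law of the random variable `G` under `P`. -/
def IsProportionalLaw {X β Ω : Type*} [MeasurableSpace β] [MeasurableSpace Ω] (w : X → ℝ≥0∞)
    (R : X → β) (P : Measure Ω) (G : Ω → β) : Prop :=
  ∃ Z : ℝ≥0∞, Z ≠ 0 ∧ Z ≠ ∞ ∧
    ∀ f : β → ℝ≥0∞, Measurable f → ∑' x, f (R x) * w x = Z * ∫⁻ ω, f (G ω) ∂P

variable {X X' β γ Ω : Type*} [MeasurableSpace β] [MeasurableSpace γ] [MeasurableSpace Ω]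
  {P : Measure Ω} {w : X → ℝ≥0∞} {w' : X' → ℝ≥0∞} {R : X → β} {R' : X' → β} {G : Ω → β}

theorem IsProportionalLaw.comp (h : IsProportionalLaw w R P G) {φ : β → γ} (hφ : Measurable φ) :
    IsProportionalLaw w (φ ∘ R) P (φ ∘ G) := by
  obtain ⟨Z, hZ₀, hZ, hf⟩ := h
  exact ⟨Z, hZ₀, hZ, fun f hfm => hf (f ∘ φ) (hfm.comp hφ)⟩

theorem IsProportionalLaw.congr_weight (h : IsProportionalLaw w R P G)
    (hw : ∀ f : β → ℝ≥0∞, ∑' x, f (R' x) * w' x = ∑' x, f (R x) * w x) :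
    IsProportionalLaw w' R' P G := by
  simpa only [IsProportionalLaw, hw] using h

theorem IsProportionalLaw.add_geometric [IsFiniteMeasure P] (h : IsProportionalLaw w R P G)
    (hG : Measurable G) {Y : Ω → ℕ} {q : ℝ≥0} (hY : IsGeometric P Y q) (hq : q < 1)
    (hindep : IndepFun G Y P) {F : ℕ → β → β} (hF : ∀ k, Measurable (F k))
    (hw : ∀ f : β → ℝ≥0∞, ∑' x, f (R' x) * w' x =
      ∑' x, (∑' k, f (F k (R x)) * (q : ℝ≥0∞) ^ k) * w x) :
    IsProportionalLaw w' R' P fun ω => F (Y ω) (G ω) := by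
  obtain ⟨Z, hZ₀, hZ, hf⟩ := h
  have hr : ENNReal.ofReal (1 - q) ≠ 0 := by
    rw [Ne, ENNReal.ofReal_eq_zero, not_le, sub_pos]
    exact_mod_cast hq
  refine ⟨Z * (ENNReal.ofReal (1 - q))⁻¹,
    mul_ne_zero hZ₀ (ENNReal.inv_ne_zero.2 ENNReal.ofReal_ne_top),
    ENNReal.mul_ne_top hZ (ENNReal.inv_ne_top.2 hr), fun f hfm => ?_⟩
  have hfF (k : ℕ) : Measurable fun b => f (F k b) := hfm.comp (hF k)
  rw [hw, hf _ (Measurable.tsum fun k => (hfF k).mul_const _),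
    lintegral_comp_isGeometric hY hG hindep.symm hfF, mul_assoc, ← mul_assoc _⁻¹,
    ENNReal.inv_mul_cancel hr ENNReal.ofReal_ne_top, one_mul]

theorem lintegral_normalizedMeasure [MeasurableSpace X] (w : X → ℝ≥0∞) {f : X → ℝ≥0∞}
    (hf : Measurable f) :
    ∫⁻ x, f x ∂normalizedMeasure w = (∑' x, w x)⁻¹ * ∑' x, f x * w x := by
  simp only [normalizedMeasure, lintegral_smul_measure, lintegral_sum_measure,
    lintegral_dirac' _ hf, smul_eq_mul, mul_comm (w _)]

theorem IsProportionalLaw.identDistrib [MeasurableSpace X] [IsProbabilityMeasure P]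
    (h : IsProportionalLaw w R P G) (hR : Measurable R) (hG : Measurable G) :
    IsProbabilityMeasure (normalizedMeasure w) ∧ IdentDistrib G R P (normalizedMeasure w) := by
  obtain ⟨Z, hZ₀, hZ, hf⟩ := h
  have tsum_w : ∑' x, w x = Z := by simpa using hf 1 measurable_one
  have map_eq : P.map G = (normalizedMeasure w).map R := by
    refine Measure.ext_of_lintegral _ fun f hfm => ?_
    have hfR : Measurable fun x => f (R x) := hfm.comp hR
    rw [lintegral_map hfm hG, lintegral_map hfm hR,
      lintegral_normalizedMeasure w hfR, tsum_w, hf f hfm, ← mul_assoc,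
      ENNReal.inv_mul_cancel hZ₀ hZ, one_mul]
  have : IsProbabilityMeasure ((normalizedMeasure w).map R) :=
    map_eq ▸ Measure.isProbabilityMeasure_map hG.aemeasurable
  exact ⟨Measure.isProbabilityMeasure_of_map R, hG.aemeasurable, hR.aemeasurable,
    map_eq⟩

end ProportionalLaws

section Heights

variable {M : ℕ} {u : Fin (M + 1) → ℕ}

/-- The heights `u 0, …, u M` along a path with `M` unit steps, to the left or upwards, from the
point `(M, 0)` to the diagonal; at time `s` the path is at the point `(M - s + u s, u s)`. -/
structure IsHeight {M : ℕ} (u : Fin (M + 1) → ℕ) : Prop where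
  zero : u 0 = 0
  step : ∀ e : Fin M, u e.succ = u e.castSucc ∨ u e.succ = u e.castSucc + 1

theorem IsHeight.monotone (hu : IsHeight u) : Monotone u :=
  Fin.monotone_iff_le_succ.2 fun e => by rcases hu.step e with h | h <;> omega

theorem IsHeight.add_le_add_of_le (hu : IsHeight u) {s t : Fin (M + 1)} (h : s ≤ t) :
    u t + s ≤ u s + t := by
  have antitone_sub : Antitone fun t : Fin (M + 1) => (u t : ℤ) - t :=
    Fin.antitone_iff_succ_le.2 fun e => by
      rcases hu.step e with h | h <;> simp only [Fin.val_succ, Fin.val_castSucc] <;> omega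
  have sub_le_sub : (u t : ℤ) - t ≤ u s - s := antitone_sub h
  omega

theorem IsHeight.eq_zero (hu : IsHeight u) (h : ∀ e : Fin M, u e.succ = u e.castSucc) :
    u = fun _ => 0 := by
  funext s
  induction s using Fin.induction with
  | zero => exact hu.zero
  | succ e ih => rw [h, ih]

theorem IsHeight.update_succ (hu : IsHeight u) {e : Fin M} (he : u e.succ = u e.castSucc + 1)
    (hlevel : ∀ e' : Fin M, e'.castSucc = e.succ → u e'.succ = u e'.castSucc) :
    IsHeight (Function.update u e.succ (u e.castSucc)) where
  zero := by rw [Function.update_of_ne (Fin.succ_ne_zero e).symm, hu.zero]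
  step e' := by
    by_cases h_eq : e' = e
    · rw [h_eq, Function.update_self, Function.update_of_ne Fin.castSucc_lt_succ.ne]
      exact Or.inl rfl
    rw [Function.update_of_ne fun h => h_eq (Fin.succ_injective _ h)]
    by_cases h_next : e'.castSucc = e.succ
    · rw [h_next, Function.update_self, hlevel e' h_next, h_next]
      exact Or.inr he
    · rw [Function.update_of_ne h_next]
      exact hu.step e'

theorem IsHeight.exists_last_up_step (hu : IsHeight u)
    (h : ¬ ∀ e : Fin M, u e.succ = u e.castSucc) :
    ∃ e : Fin M, u e.succ = u e.castSucc + 1 ∧ ∀ e' > e, u e'.succ = u e'.castSucc := by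
  obtain ⟨e, he, hmax⟩ := (Set.toFinite {e : Fin M | u e.succ ≠ u e.castSucc}).exists_maximal
    (not_forall.1 h)
  exact ⟨e, (hu.step e).resolve_left he, fun e' h => not_not.1 fun h' => (hmax h' h.le).not_gt h⟩

/-- Raising a height by one adds a box to the region under the path, at an inner corner or at the
diagonal; lowering the end of the last upward step removes such a box. -/
theorem IsHeight.induction {motive : ∀ M, (Fin (M + 1) → ℕ) → Prop}
    (flat : ∀ M, motive M fun _ => 0)
    (corner : ∀ M (u : Fin (M + 2) → ℕ) (e : Fin M), IsHeight u →
      u e.castSucc.succ = u e.castSucc.castSucc → u e.succ.succ = u e.castSucc.succ + 1 →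
      motive (M + 1) u →
      motive (M + 1) (Function.update u e.castSucc.succ (u e.castSucc.succ + 1)))
    (boundary : ∀ M (u : Fin (M + 2) → ℕ), IsHeight u →
      u (Fin.last M).succ = u (Fin.last M).castSucc → motive (M + 1) u →
      motive (M + 1) (Function.update u (Fin.last M).succ (u (Fin.last M).succ + 1)))
    (hu : IsHeight u) : motive M u := by
  induction hn : ∑ s, u s using Nat.strong_induction_on generalizing u with
  | _ n ih =>
  subst hn
  by_cases hflat : ∀ e : Fin M, u e.succ = u e.castSucc
  · rw [hu.eq_zero hflat]
    exact flat M
  obtain ⟨e, he, hlevel⟩ := hu.exists_last_up_step hflat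
  set u' := Function.update u e.succ (u e.castSucc) with hu'_def
  have hu' : IsHeight u' := hu.update_succ he fun e' h =>
    hlevel e' (Fin.castSucc_lt_castSucc_iff.1 (h ▸ Fin.castSucc_lt_succ))
  have u'_prev : u' e.castSucc = u e.castSucc := Function.update_of_ne Fin.castSucc_lt_succ.ne _ _
  have u'_self : u' e.succ = u e.castSucc := Function.update_self _ _ _
  have u'_next (e' : Fin M) (h : e < e') : u' e'.succ = u e'.succ :=
    Function.update_of_ne (Fin.succ_lt_succ_iff.2 h).ne' _ _
  have sum_lt : ∑ s, u' s < ∑ s, u s := by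
    refine Fintype.sum_strictMono (Pi.lt_def.2 ⟨fun s => ?_, e.succ, by omega⟩)
    by_cases hs : s = e.succ
    · rw [hs, u'_self, he]
      exact Nat.le_succ _
    · exact (Function.update_of_ne hs _ _).le
  have motive_u' := ih _ sum_lt hu' rfl
  have raise : Function.update u' e.succ (u' e.succ + 1) = u := by
    rw [u'_self, ← he, hu'_def, Function.update_idem, Function.update_eq_self]
  rw [← raise]
  cases M with
  | zero => exact e.elim0
  | succ M =>
  induction e using Fin.lastCases with
  | last => exact boundary M u' hu' (u'_self.trans u'_prev.symm) motive_u'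
  | cast e =>
    refine corner M u' e hu' (u'_self.trans u'_prev.symm) ?_ motive_u'
    rw [u'_next _ Fin.castSucc_lt_succ, u'_self, hlevel _ Fin.castSucc_lt_succ, ← he,
      Fin.succ_castSucc]

/-- The last passage times along the path with heights `u`. -/
def heightPassage (g : ℕ → ℕ → ℕ) (u : Fin (M + 1) → ℕ) (s : Fin (M + 1)) : ℕ :=
  lastPassage g (M - s + u s) (u s)

theorem heightPassage_update (g : ℕ → ℕ → ℕ) (u : Fin (M + 1) → ℕ) (v : Fin (M + 1)) (q : ℕ) :
    heightPassage g (Function.update u v q) =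
      Function.update (heightPassage g u) v (lastPassage g (M - v + q) q) := by
  funext s
  by_cases hs : s = v
  · simp only [hs, heightPassage, Function.update_self]
  · simp only [heightPassage, Function.update_of_ne hs]

theorem heightPassage_update_corner (g : ℕ → ℕ → ℕ) {u : Fin (M + 2) → ℕ} {e : Fin M}
    (hprev : u e.castSucc.succ = u e.castSucc.castSucc)
    (hnext : u e.succ.succ = u e.castSucc.succ + 1) :
    heightPassage g (Function.update u e.castSucc.succ (u e.castSucc.succ + 1)) =
      Function.update (heightPassage g u) e.castSucc.succ
        (max (heightPassage g u e.castSucc.castSucc) (heightPassage g u e.succ.succ) +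
          g (M - e + u e.castSucc.succ + 1) (u e.castSucc.succ + 1)) := by
  have he := e.2
  rw [heightPassage_update]
  congr 1
  simp only [heightPassage, hnext, ← hprev, Fin.val_succ, Fin.val_castSucc]
  rw [show M + 1 - (e + 1) + (u e.castSucc.succ + 1) = M - e + u e.castSucc.succ + 1 by omega,
    show M + 1 - (e + 1 + 1) + (u e.castSucc.succ + 1) = M - e + u e.castSucc.succ by omega,
    show M + 1 - e + u e.castSucc.succ = M - e + u e.castSucc.succ + 1 by omega,
    lastPassage_succ_succ g (by omega), max_comm]

theorem heightPassage_update_boundary (g : ℕ → ℕ → ℕ) {u : Fin (M + 2) → ℕ}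
    (hprev : u (Fin.last M).succ = u (Fin.last M).castSucc) :
    heightPassage g (Function.update u (Fin.last M).succ (u (Fin.last M).succ + 1)) =
      Function.update (heightPassage g u) (Fin.last M).succ
        (heightPassage g u (Fin.last M).castSucc +
          g (u (Fin.last M).succ + 1) (u (Fin.last M).succ + 1)) := by
  rw [heightPassage_update]
  congr 1
  simp only [heightPassage, ← hprev, Fin.val_succ, Fin.val_castSucc, Fin.val_last]
  rw [Nat.sub_self, zero_add, lastPassage_succ_self, Nat.add_sub_cancel_left, Nat.add_comm 1]

end Heights

section Resampling

theorem tsum_congr_update {ι Y : Type*} [DecidableEq ι] (v : ι) {F F' : (ι → Y) → ℝ≥0∞}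
    (h : ∀ x, ∑' y, F (Function.update x v y) = ∑' y, F' (Function.update x v y)) :
    ∑' x, F x = ∑' x, F' x := by
  rcases isEmpty_or_nonempty Y with hY | ⟨⟨y₀⟩⟩
  · have : IsEmpty (ι → Y) := ⟨fun x => hY.false (x v)⟩
    rw [tsum_empty, tsum_empty]
  have split (F : (ι → Y) → ℝ≥0∞) : ∑' x, F x = ∑' r : {j // j ≠ v} → Y, ∑' y,
      F (Function.update ((Equiv.funSplitAt v Y).symm (y₀, r)) v y) := by
    rw [ENNReal.tsum_comm, ← ENNReal.tsum_prod, ← (Equiv.funSplitAt v Y).symm.tsum_eq]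
    refine tsum_congr fun z => congrArg F (funext fun j => ?_)
    by_cases hj : j = v
    · subst hj
      simp only [Equiv.funSplitAt_symm_apply, dif_pos, Function.update_self]
    · simp only [Equiv.funSplitAt_symm_apply, dif_neg hj, Function.update_of_ne hj]
  rw [split F, split F']
  exact tsum_congr fun r => h _

variable {ι : Type*}

/-- The lengths of the first rows of a family of partitions. -/
def firstRows (lam : ι → YoungDiagram) (s : ι) : ℕ := (lam s).rowLen 0

variable [DecidableEq ι]

theorem firstRows_update (lam : ι → YoungDiagram) (v : ι) (κ : YoungDiagram) :
    firstRows (Function.update lam v κ) = Function.update (firstRows lam) v (κ.rowLen 0) :=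
  Function.comp_update (fun κ : YoungDiagram => κ.rowLen 0) lam v κ

theorem tsum_firstRows_update {w w' : (ι → YoungDiagram) → ℝ≥0∞} {v : ι} {m : (ι → ℕ) → ℕ}
    {q : ℝ≥0} (hm : ∀ x y, m (Function.update x v y) = m x)
    (hw : ∀ lam, ∀ φ : ℕ → ℝ≥0∞, ∑' κ, φ (κ.rowLen 0) * w' (Function.update lam v κ) =
      (∑' k, φ (m (firstRows lam) + k) * (q : ℝ≥0∞) ^ k) * ∑' κ, w (Function.update lam v κ))
    (f : (ι → ℕ) → ℝ≥0∞) :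
    ∑' lam, f (firstRows lam) * w' lam =
      ∑' lam, (∑' k, f (Function.update (firstRows lam) v (m (firstRows lam) + k)) *
        (q : ℝ≥0∞) ^ k) * w lam := by
  refine tsum_congr_update v fun lam => ?_
  simp only [firstRows_update, Function.update_idem, hm]
  rw [hw lam fun y => f (Function.update (firstRows lam) v y), ENNReal.tsum_mul_left]

theorem IsProportionalLaw.update_firstRows [Countable ι] {Ω : Type*} [MeasurableSpace Ω]
    {P : Measure Ω} [IsFiniteMeasure P] {w w' : (ι → YoungDiagram) → ℝ≥0∞} {G : Ω → ι → ℕ}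
    (h : IsProportionalLaw w firstRows P G) (hG : Measurable G) {Y : Ω → ℕ} {q : ℝ≥0}
    (hY : IsGeometric P Y q) (hq : q < 1) (hindep : IndepFun G Y P) {v : ι} {m : (ι → ℕ) → ℕ}
    (hm_meas : Measurable m) (hm : ∀ x y, m (Function.update x v y) = m x)
    (hw : ∀ lam, ∀ φ : ℕ → ℝ≥0∞, ∑' κ, φ (κ.rowLen 0) * w' (Function.update lam v κ) =
      (∑' k, φ (m (firstRows lam) + k) * (q : ℝ≥0∞) ^ k) * ∑' κ, w (Function.update lam v κ)) :
    IsProportionalLaw w' firstRows P fun ω => Function.update (G ω) v (m (G ω) + Y ω) :=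
  h.add_geometric hG hY hq hindep (F := fun k x => Function.update x v (m x + k))
    (fun k => by fun_prop) (tsum_firstRows_update hm hw)

end Resampling

section HeightWeights

variable {M : ℕ} (a : ℕ → ℝ≥0) (c : ℝ≥0)

/-- The weight of a step from height `q` to height `q'`, starting at abscissa `p` with the
partition `y` and ending with the partition `z`. -/
noncomputable def edgeKernel (p q q' : ℕ) (y z : YoungDiagram) : ℝ≥0∞ :=
  if q' = q + 1 then skewSchur [a q'] z y else skewSchur [a p] y z

theorem edgeKernel_up (p q : ℕ) (y z : YoungDiagram) :
    edgeKernel a p q (q + 1) y z = skewSchur [a (q + 1)] z y :=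
  if_pos rfl

theorem edgeKernel_level (p q : ℕ) (y z : YoungDiagram) :
    edgeKernel a p q q y z = skewSchur [a p] y z :=
  if_neg q.lt_succ_self.ne

open Classical in
/-- The weight of the Pfaffian Schur process indexed by the path with heights `u`, which starts with
the empty partition. -/
noncomputable def heightWeight (u : Fin (M + 1) → ℕ) (lam : Fin (M + 1) → YoungDiagram) : ℝ≥0∞ :=
  (if lam 0 = ⊥ then 1 else 0) *
    (∏ e : Fin M, edgeKernel a (M - e + u e.castSucc) (u e.castSucc) (u e.succ)
      (lam e.castSucc) (lam e.succ)) *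
    tauSchur [c] (lam (Fin.last M))

theorem heightWeight_update_corner (u : Fin (M + 2) → ℕ) (lam : Fin (M + 2) → YoungDiagram)
    (e : Fin M) : ∃ r : ℝ≥0∞, ∀ q κ,
      heightWeight a c (Function.update u e.castSucc.succ q)
          (Function.update lam e.castSucc.succ κ) =
        r * (edgeKernel a (M + 1 - e + u e.castSucc.castSucc) (u e.castSucc.castSucc) q
            (lam e.castSucc.castSucc) κ *
          edgeKernel a (M - e + q) q (u e.succ.succ) κ (lam e.succ.succ)) := by
  classical
  have ne_zero : (0 : Fin (M + 2)) ≠ e.castSucc.succ := (Fin.succ_ne_zero _).symm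
  have ne_last : Fin.last (M + 1) ≠ e.castSucc.succ := by
    rw [Fin.succ_castSucc]
    exact (Fin.castSucc_lt_last _).ne'
  have ne_edge : e.castSucc ≠ e.succ := Fin.castSucc_lt_succ.ne
  have ne_prev : e.castSucc.castSucc ≠ e.castSucc.succ := Fin.castSucc_lt_succ.ne
  have ne_next : e.succ.succ ≠ e.castSucc.succ := fun h => ne_edge (Fin.succ_injective _ h).symm
  refine ⟨(if lam 0 = ⊥ then 1 else 0) * (∏ e' ∈ ({e.castSucc, e.succ} : Finset (Fin (M + 1)))ᶜ,
    edgeKernel a (M + 1 - e' + u e'.castSucc) (u e'.castSucc) (u e'.succ)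
      (lam e'.castSucc) (lam e'.succ)) * tauSchur [c] (lam (Fin.last (M + 1))), fun q κ => ?_⟩
  rw [heightWeight, ← Finset.prod_mul_prod_compl {e.castSucc, e.succ}, Finset.prod_pair ne_edge,
    ← Fin.succ_castSucc, Function.update_of_ne ne_zero, Function.update_of_ne ne_last,
    Finset.prod_congr rfl fun e' he' => ?_]
  · simp only [Function.update_self, Function.update_of_ne ne_prev, Function.update_of_ne ne_next,
      Fin.val_castSucc, Fin.val_succ, Nat.add_sub_add_right]
    ring
  · simp only [Finset.mem_compl, Finset.mem_insert, Finset.mem_singleton, not_or] at he'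
    have ne_succ : e'.succ ≠ e.castSucc.succ := fun h => he'.1 (Fin.succ_injective _ h)
    have ne_castSucc : e'.castSucc ≠ e.castSucc.succ :=
      fun h => he'.2 (Fin.castSucc_injective _ h)
    simp only [Function.update_of_ne ne_succ, Function.update_of_ne ne_castSucc]

theorem heightWeight_update_boundary (u : Fin (M + 2) → ℕ) (lam : Fin (M + 2) → YoungDiagram) :
    ∃ r : ℝ≥0∞, ∀ q κ,
      heightWeight a c (Function.update u (Fin.last M).succ q)
          (Function.update lam (Fin.last M).succ κ) =
        r * (tauSchur [c] κ * edgeKernel a (1 + u (Fin.last M).castSucc)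
          (u (Fin.last M).castSucc) q (lam (Fin.last M).castSucc) κ) := by
  classical
  have ne_zero : (0 : Fin (M + 2)) ≠ (Fin.last M).succ := (Fin.succ_ne_zero _).symm
  have ne_prev : (Fin.last M).castSucc ≠ (Fin.last M).succ := Fin.castSucc_lt_succ.ne
  refine ⟨(if lam 0 = ⊥ then 1 else 0) * ∏ e : Fin M, edgeKernel a
    (M + 1 - e + u e.castSucc.castSucc) (u e.castSucc.castSucc) (u e.castSucc.succ)
      (lam e.castSucc.castSucc) (lam e.castSucc.succ), fun q κ => ?_⟩
  rw [heightWeight, Fin.prod_univ_castSucc, Function.update_of_ne ne_zero,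
    Finset.prod_congr rfl fun e _ => ?_]
  · simp only [← Fin.succ_last, Function.update_self, Function.update_of_ne ne_prev, Fin.val_last,
      Nat.add_sub_cancel_left]
    ring
  · have ne_succ : e.castSucc.succ ≠ (Fin.last M).succ :=
      fun h => (Fin.castSucc_lt_last e).ne (Fin.succ_injective _ h)
    have ne_castSucc : e.castSucc.castSucc ≠ (Fin.last M).succ := (Fin.castSucc_lt_last _).ne
    simp only [Function.update_of_ne ne_succ, Function.update_of_ne ne_castSucc, Fin.val_castSucc]

theorem tsum_heightWeight_corner {u : Fin (M + 2) → ℕ} {e : Fin M}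
    (hprev : u e.castSucc.succ = u e.castSucc.castSucc)
    (hnext : u e.succ.succ = u e.castSucc.succ + 1) (lam : Fin (M + 2) → YoungDiagram)
    (φ : ℕ → ℝ≥0∞) :
    ∑' κ, φ (κ.rowLen 0) * heightWeight a c
        (Function.update u e.castSucc.succ (u e.castSucc.succ + 1))
        (Function.update lam e.castSucc.succ κ) =
      (∑' k, φ (max (firstRows lam e.castSucc.castSucc) (firstRows lam e.succ.succ) + k) *
        ((a (M - e + u e.castSucc.succ + 1) * a (u e.castSucc.succ + 1) : ℝ≥0) : ℝ≥0∞) ^ k) *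
      ∑' κ, heightWeight a c u (Function.update lam e.castSucc.succ κ) := by
  obtain ⟨r, hr⟩ := heightWeight_update_corner a c u lam e
  have outer := hr (u e.castSucc.succ + 1)
  have inner := hr (u e.castSucc.succ)
  rw [Function.update_eq_self] at inner
  have abscissa : M + 1 - e + u e.castSucc.succ = M - e + u e.castSucc.succ + 1 := by omega
  simp only [outer, inner, hnext, ← hprev, edgeKernel_up, edgeKernel_level, ENNReal.tsum_mul_left,
    mul_left_comm _ r, abscissa, ← add_assoc]
  rw [mul_comm (a (M - e + _ + 1)), firstRows, firstRows, tsum_mul_skewSchur_mul_skewSchur]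
  simp only [mul_comm (skewSchur [a (M - e + _ + 1)] _ _)]

theorem tsum_heightWeight_boundary {u : Fin (M + 2) → ℕ}
    (hprev : u (Fin.last M).succ = u (Fin.last M).castSucc) (lam : Fin (M + 2) → YoungDiagram)
    (φ : ℕ → ℝ≥0∞) :
    ∑' κ, φ (κ.rowLen 0) * heightWeight a c
        (Function.update u (Fin.last M).succ (u (Fin.last M).succ + 1))
        (Function.update lam (Fin.last M).succ κ) =
      (∑' k, φ (firstRows lam (Fin.last M).castSucc + k) *
        ((c * a (u (Fin.last M).succ + 1) : ℝ≥0) : ℝ≥0∞) ^ k) *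
      ∑' κ, heightWeight a c u (Function.update lam (Fin.last M).succ κ) := by
  obtain ⟨r, hr⟩ := heightWeight_update_boundary a c u lam
  have outer := hr (u (Fin.last M).succ + 1)
  have inner := hr (u (Fin.last M).succ)
  rw [Function.update_eq_self] at inner
  simp only [outer, inner, ← hprev, edgeKernel_up, edgeKernel_level, ENNReal.tsum_mul_left,
    mul_left_comm _ r, Nat.add_comm 1]
  rw [firstRows, tsum_mul_tauSchur_mul_skewSchur]

end HeightWeights

section HeightLaws

variable {M : ℕ} {u : Fin (M + 1) → ℕ} {a : ℕ → ℝ≥0} {c : ℝ≥0}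

theorem eq_bot_of_heightWeight_ne_zero (hu : IsHeight u) {lam : Fin (M + 1) → YoungDiagram}
    (h : heightWeight a c u lam ≠ 0) {s : Fin (M + 1)} (hs : u s = 0) : lam s = ⊥ := by
  classical
  have factors_ne_zero := left_ne_zero_of_mul h
  induction s using Fin.induction with
  | zero => exact (ite_ne_right_iff.1 (left_ne_zero_of_mul factors_ne_zero)).1
  | succ e ih =>
    have hprev : u e.castSucc = 0 :=
      Nat.le_zero.1 (hs ▸ hu.monotone Fin.castSucc_lt_succ.le)
    have edge_ne_zero := Finset.prod_ne_zero_iff.1 (right_ne_zero_of_mul factors_ne_zero) e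
      (Finset.mem_univ e)
    rw [hs, hprev, edgeKernel_level, ih hprev] at edge_ne_zero
    exact interlaces_bot_iff.1 (interlaces_of_skewSchur_singleton_ne_zero edge_ne_zero)

theorem heightWeight_flat_bot : heightWeight a c (fun _ : Fin (M + 1) => 0) ⊥ = 1 := by
  simp [heightWeight, edgeKernel_level, tauSchur_singleton_bot,
    skewSchur_singleton_of_interlaces _ (interlaces_refl ⊥)]

variable {Ω : Type*} [MeasurableSpace Ω] {P : Measure Ω} {g : ℕ → ℕ → Ω → ℕ}

theorem isProportionalLaw_flat [IsProbabilityMeasure P] :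
    IsProportionalLaw (heightWeight a c fun _ : Fin (M + 1) => 0) firstRows P
      fun ω => heightPassage (fun p q => g p q ω) fun _ => 0 := by
  have isHeight_flat : IsHeight fun _ : Fin (M + 1) => 0 := ⟨rfl, fun _ => Or.inl rfl⟩
  refine ⟨1, one_ne_zero, ENNReal.one_ne_top, fun f _ => ?_⟩
  rw [tsum_eq_single ⊥ fun lam hlam => ?_]
  · have firstRows_bot : firstRows (⊥ : Fin (M + 1) → YoungDiagram) = fun _ => 0 :=
      funext fun _ => rowLen_bot 0
    have passage_flat (ω : Ω) :
        heightPassage (fun p q => g p q ω) (fun _ : Fin (M + 1) => 0) = fun _ => 0 :=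
      funext fun _ => lastPassage_zero_right _ _
    simp only [firstRows_bot, passage_flat, heightWeight_flat_bot, lintegral_const, measure_univ,
      mul_one, one_mul]
  · rw [mul_eq_zero, or_iff_not_imp_right]
    exact fun h => absurd (funext fun _ => eq_bot_of_heightWeight_ne_zero isHeight_flat h rfl) hlam

theorem IsGeometricEnvironment.measurable_heightPassage (hg : IsGeometricEnvironment P a c g)
    (u : Fin (M + 1) → ℕ) : Measurable fun ω => heightPassage (fun p q => g p q ω) u :=
  measurable_pi_iff.2 fun _ => measurable_lastPassage (Nat.le_add_left _ _) fun p q hq hqp _ _ =>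
    hg.measurable p q hq hqp

theorem IsProportionalLaw.corner [IsFiniteMeasure P] (hg : IsGeometricEnvironment P a c g)
    {u : Fin (M + 2) → ℕ} {e : Fin M} (hu : IsHeight u)
    (hprev : u e.castSucc.succ = u e.castSucc.castSucc)
    (hnext : u e.succ.succ = u e.castSucc.succ + 1)
    (h : IsProportionalLaw (heightWeight a c u) firstRows P
      fun ω => heightPassage (fun p q => g p q ω) u) :
    IsProportionalLaw
      (heightWeight a c (Function.update u e.castSucc.succ (u e.castSucc.succ + 1))) firstRows P
      fun ω => heightPassage (fun p q => g p q ω)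
        (Function.update u e.castSucc.succ (u e.castSucc.succ + 1)) := by
  have he := e.2
  have ne_prev : e.castSucc.castSucc ≠ e.castSucc.succ := Fin.castSucc_lt_succ.ne
  have ne_next : e.succ.succ ≠ e.castSucc.succ := (Fin.succ_lt_succ_iff.2 Fin.castSucc_lt_succ).ne'
  have off_diagonal : u e.castSucc.succ + 1 < M - e + u e.castSucc.succ + 1 := by omega
  simp only [heightPassage_update_corner _ hprev hnext]
  refine h.update_firstRows (hg.measurable_heightPassage u)
    (hg.isGeometric _ _ (Nat.le_add_left 1 _) off_diagonal)
    (hg.mul_lt_one _ _ (Nat.le_add_left 1 _) off_diagonal) ?_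
    (m := fun x => max (x e.castSucc.castSucc) (x e.succ.succ)) (by fun_prop)
    (fun x y => by rw [Function.update_of_ne ne_prev, Function.update_of_ne ne_next])
    (tsum_heightWeight_corner a c hprev hnext)
  refine indepFun_lastPassage hg.measurable hg.iIndepFun (fun s => Nat.le_add_left _ _)
    (Nat.le_add_left 1 _) off_diagonal.le fun s hs => ?_
  have next_le : e.succ.succ ≤ s := by
    by_contra! hlt
    exact absurd (hu.monotone (Fin.le_castSucc_iff.2 hlt)) (by rw [← Fin.succ_castSucc]; omega)
  have := hu.add_le_add_of_le next_le
  simp only [Fin.val_succ] at this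
  omega

theorem IsProportionalLaw.boundary [IsFiniteMeasure P] (hg : IsGeometricEnvironment P a c g)
    {u : Fin (M + 2) → ℕ} (hu : IsHeight u)
    (hprev : u (Fin.last M).succ = u (Fin.last M).castSucc)
    (h : IsProportionalLaw (heightWeight a c u) firstRows P
      fun ω => heightPassage (fun p q => g p q ω) u) :
    IsProportionalLaw
      (heightWeight a c (Function.update u (Fin.last M).succ (u (Fin.last M).succ + 1))) firstRows P
      fun ω => heightPassage (fun p q => g p q ω)
        (Function.update u (Fin.last M).succ (u (Fin.last M).succ + 1)) := by
  have ne_prev : (Fin.last M).castSucc ≠ (Fin.last M).succ := Fin.castSucc_lt_succ.ne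
  simp only [heightPassage_update_boundary _ hprev]
  refine h.update_firstRows (hg.measurable_heightPassage u)
    (hg.isGeometric_diag _ (Nat.le_add_left 1 _)) (hg.diag_lt_one _ (Nat.le_add_left 1 _)) ?_
    (m := fun x => x (Fin.last M).castSucc) (by fun_prop)
    (fun x y => Function.update_of_ne ne_prev _ _) (tsum_heightWeight_boundary a c hprev)
  refine indepFun_lastPassage hg.measurable hg.iIndepFun (fun s => Nat.le_add_left _ _)
    (Nat.le_add_left 1 _) le_rfl fun s hs => absurd (hu.monotone (Fin.le_last s)) ?_
  rw [← Fin.succ_last]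
  omega

theorem isProportionalLaw_heightWeight [IsProbabilityMeasure P]
    (hg : IsGeometricEnvironment P a c g) (hu : IsHeight u) :
    IsProportionalLaw (heightWeight a c u) firstRows P
      fun ω => heightPassage (fun p q => g p q ω) u :=
  hu.induction (motive := fun _ u => IsProportionalLaw (heightWeight a c u) firstRows P
      fun ω => heightPassage (fun p q => g p q ω) u)
    (fun _ => isProportionalLaw_flat)
    (fun _ _ _ hu hprev hnext h => h.corner hg hu hprev hnext)
    (fun _ _ hu hprev h => h.boundary hg hu hprev)

end HeightLaws

namespace ZigZagPath

variable (γ : ZigZagPath)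

/-- The heights of the vertices of a path. -/
def height (s : Fin (γ.len + 1)) : ℕ := (γ.vertex s).2

theorem isHeight_height : IsHeight γ.height where
  zero := γ.start
  step e := (γ.step e).imp (fun h => h.2.symm) fun h => h.2

theorem fst_vertex (s : Fin (γ.len + 1)) : (γ.vertex s).1 = γ.len - s + γ.height s := by
  have fst_add (s : Fin (γ.len + 1)) :
      (γ.vertex s).1 + s = (γ.vertex s).2 + (γ.vertex 0).1 := by
    induction s using Fin.induction with
    | zero => rw [γ.start, Fin.val_zero, add_comm]
    | succ e ih =>
      simp only [Fin.val_castSucc, Fin.val_succ] at ih ⊢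
      rcases γ.step e with h | h <;> omega
  have fst_zero : (γ.vertex 0).1 = γ.len := by
    simpa [γ.finish, eq_comm] using fst_add (Fin.last γ.len)
  have := fst_add s
  have := s.is_le
  rw [height]
  omega

theorem edgeWeight_label (a : ℕ → ℝ≥0) (lam : Fin (γ.len + 1) → YoungDiagram) (e : Fin γ.len) :
    γ.edgeWeight (γ.label a) lam e =
      edgeKernel a (γ.len - e + γ.height e.castSucc) (γ.height e.castSucc) (γ.height e.succ)
        (lam e.castSucc) (lam e.succ) := by
  have fst_castSucc := γ.fst_vertex e.castSucc
  rw [Fin.val_castSucc] at fst_castSucc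
  rw [edgeWeight, label, edgeKernel, ← fst_castSucc]
  exact ite_congr rfl (fun h => by rw [if_pos (show γ.IsUp e from h)]; rfl)
    fun h => by rw [if_neg (show ¬ γ.IsUp e from h)]

theorem weight_label (a : ℕ → ℝ≥0) (c : ℝ≥0) :
    γ.weight [c] (γ.label a) = heightWeight a c γ.height := by
  classical
  funext lam
  rw [weight]
  split_ifs with h
  · simp only [heightWeight, edgeWeight_label, if_pos (h 0 γ.start), one_mul, mul_comm]
  · contrapose! h
    exact fun s => eq_bot_of_heightWeight_ne_zero γ.isHeight_height h.symm

theorem isProportionalLaw_weight {Ω : Type*} [MeasurableSpace Ω] {P : Measure Ω}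
    [IsProbabilityMeasure P] {a : ℕ → ℝ≥0} {c : ℝ≥0} {g : ℕ → ℕ → Ω → ℕ}
    (hg : IsGeometricEnvironment P a c g) :
    IsProportionalLaw (γ.weight [c] (γ.label a)) firstRows P
      fun ω s => lastPassage (fun p q => g p q ω) (γ.vertex s).1 (γ.vertex s).2 := by
  simp only [weight_label, fst_vertex]
  exact isProportionalLaw_heightWeight hg γ.isHeight_height

end ZigZagPath

section Chain

variable {Y : Type*}

theorem tsum_pi_snoc {n : ℕ} (F : (Fin (n + 1) → Y) → ℝ≥0∞) :
    ∑' x, F x = ∑' x : Fin n → Y, ∑' y, F (Fin.snoc x y) := by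
  rw [ENNReal.tsum_comm, ← ENNReal.tsum_prod, ← (Fin.snocEquiv fun _ => Y).tsum_eq]
  rfl

theorem tsum_pi_cons {n : ℕ} (F : (Fin (n + 1) → Y) → ℝ≥0∞) :
    ∑' x, F x = ∑' y, ∑' x : Fin n → Y, F (Fin.cons y x) := by
  rw [← ENNReal.tsum_prod, ← (Fin.consEquiv fun _ => Y).tsum_eq]
  rfl

theorem tsum_pi_one (F : (Fin 1 → Y) → ℝ≥0∞) : ∑' x, F x = ∑' y, F fun _ => y :=
  ((Equiv.funUnique (Fin 1) Y).symm.tsum_eq F).symm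

theorem tsum_pi_prod {n : ℕ} (A : Fin n → Y → ℝ≥0∞) :
    ∑' x : Fin n → Y, ∏ k, A k (x k) = ∏ k, ∑' y, A k y := by
  induction n with
  | zero => simp
  | succ n ih =>
    rw [tsum_pi_cons]
    simp only [Fin.prod_univ_succ, Fin.cons_zero, Fin.cons_succ, ENNReal.tsum_mul_left, ih,
      ENNReal.tsum_mul_right]

theorem tsum_mul_single [DecidableEq Y] (F : Y → ℝ≥0∞) (y : Y) :
    ∑' z, F z * (Pi.single y 1 : Y → ℝ≥0∞) z = F y := by
  simp [Pi.single_apply]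

/-- The weight of a trajectory `x` of an inhomogeneous chain on `Y` with initial weights `A`,
transition weights `K e` at the times `e < M` and final weights `B`. -/
noncomputable def chainWeight (A : Y → ℝ≥0∞) (K : ℕ → Y → Y → ℝ≥0∞) (B : Y → ℝ≥0∞) {M : ℕ}
    (x : Fin (M + 1) → Y) : ℝ≥0∞ :=
  A (x 0) * (∏ e : Fin M, K e (x e.castSucc) (x e.succ)) * B (x (Fin.last M))

open Classical in
/-- The transition weights of an inhomogeneous chain from time `s` to time `s + d`. -/
noncomputable def transition (K : ℕ → Y → Y → ℝ≥0∞) (s : ℕ) : ℕ → Y → Y → ℝ≥0∞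
  | 0, y, z => if y = z then 1 else 0
  | d + 1, y, z => ∑' w, transition K s d y w * K (s + d) w z

theorem tsum_transition_zero_mul (K : ℕ → Y → Y → ℝ≥0∞) (s : ℕ) (B : Y → ℝ≥0∞) (y : Y) :
    ∑' z, transition K s 0 y z * B z = B y := by
  classical
  simp [transition]

theorem transition_add (K : ℕ → Y → Y → ℝ≥0∞) (s d d' : ℕ) (y z : Y) :
    transition K s (d + d') y z =
      ∑' w, transition K s d y w * transition K (s + d) d' w z := by
  induction d' generalizing z with
  | zero =>
    classical
    simp [transition]
  | succ d' ih =>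
    rw [← add_assoc]
    simp only [transition, ih, ← add_assoc, ← ENNReal.tsum_mul_left, ← ENNReal.tsum_mul_right,
      mul_assoc]
    exact ENNReal.tsum_comm

theorem tsum_mul_chainWeight_restrict (A : Y → ℝ≥0∞) (K : ℕ → Y → Y → ℝ≥0∞) (B : Y → ℝ≥0∞)
    {t M : ℕ} (h : t ≤ M) (F : (Fin (t + 1) → Y) → ℝ≥0∞) :
    ∑' x : Fin (M + 1) → Y, F (fun s => x (s.castLE (Nat.succ_le_succ h))) * chainWeight A K B x =
      ∑' x, F x * chainWeight A K (fun y => ∑' z, transition K t (M - t) y z * B z) x := by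
  induction M, h using Nat.le_induction generalizing B with
  | base => simp only [Nat.sub_self, tsum_transition_zero_mul]; rfl
  | succ M h ih =>
    have tsum_transition_succ (y : Y) : ∑' z, transition K t (M + 1 - t) y z * B z =
        ∑' w, transition K t (M - t) y w * ∑' z, K M w z * B z := by
      simp only [Nat.sub_add_comm h, transition, Nat.add_sub_cancel' h, ← ENNReal.tsum_mul_left,
        ← ENNReal.tsum_mul_right, mul_assoc]
      exact ENNReal.tsum_comm
    simp only [tsum_transition_succ, ← ih]
    refine (tsum_pi_snoc (n := M + 1) _).trans (tsum_congr fun x => ?_)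
    have restrict_snoc (z : Y) (s : Fin (t + 1)) :
        Fin.snoc (α := fun _ => Y) x z (s.castLE (Nat.succ_le_succ (h.trans M.le_succ))) =
          x (s.castLE (Nat.succ_le_succ h)) :=
      Fin.snoc_castSucc (α := fun _ => Y) z x (s.castLE (Nat.succ_le_succ h))
    have chainWeight_snoc (z : Y) :
        chainWeight A K B (Fin.snoc (α := fun _ => Y) x z) =
          A (x 0) * (∏ e : Fin M, K e (x e.castSucc) (x e.succ)) *
            (K M (x (Fin.last M)) z * B z) := by
      rw [chainWeight, Fin.prod_univ_castSucc]
      simp only [← Fin.castSucc_zero, Fin.succ_castSucc, Fin.snoc_castSucc, Fin.succ_last,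
        Fin.snoc_last, Fin.val_castSucc, Fin.val_last]
      ring
    simp only [restrict_snoc, chainWeight_snoc, ENNReal.tsum_mul_left]
    rfl

theorem tsum_mul_chainWeight_split [DecidableEq Y] (A : Y → ℝ≥0∞) (K : ℕ → Y → Y → ℝ≥0∞)
    (B : Y → ℝ≥0∞) {t M : ℕ} (h : t ≤ M) (F : Y → (Fin (t + 1) → Y) → ℝ≥0∞) :
    ∑' x : Fin (M + 1) → Y,
        F (x ⟨t, Nat.lt_succ_of_le h⟩) (fun s => x (s.castLE (Nat.succ_le_succ h))) *
          chainWeight A K B x =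
      ∑' y, (∑' x, F y x * chainWeight A K (Pi.single y 1) x) *
        ∑' z, transition K t (M - t) y z * B z := by
  refine (tsum_mul_chainWeight_restrict A K B h fun x => F (x (Fin.last t)) x).trans ?_
  simp only [← ENNReal.tsum_mul_right]
  rw [ENNReal.tsum_comm]
  refine tsum_congr fun x => ?_
  rw [tsum_eq_single (x (Fin.last t)) fun y hy => by simp [chainWeight, hy.symm]]
  simp only [chainWeight, Pi.single_eq_same, mul_one, mul_assoc]

theorem tsum_chainWeight_single [DecidableEq Y] (A : Y → ℝ≥0∞) (K : ℕ → Y → Y → ℝ≥0∞) (M : ℕ)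
    (y : Y) :
    ∑' x : Fin (M + 1) → Y, chainWeight A K (Pi.single y 1) x =
      ∑' z, A z * transition K 0 M z y := by
  have restrict_zero := tsum_mul_chainWeight_restrict A K (Pi.single y 1) M.zero_le fun _ => 1
  simp only [one_mul, Nat.sub_zero] at restrict_zero
  rw [restrict_zero]
  refine (tsum_pi_one _).trans (tsum_congr fun z => ?_)
  simp only [chainWeight, tsum_mul_single, Finset.univ_eq_empty, Finset.prod_empty, mul_one]

theorem tsum_mul_chainWeight_marginal (A : Y → ℝ≥0∞) (K : ℕ → Y → Y → ℝ≥0∞) (B : Y → ℝ≥0∞)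
    {n M : ℕ} {T : Fin (n + 1) → ℕ} (hT : Antitone T) (hTM : ∀ k, T k ≤ M)
    (f : (Fin (n + 1) → Y) → ℝ≥0∞) :
    ∑' x : Fin (M + 1) → Y,
        f (fun k => x ⟨T k, Nat.lt_succ_of_le (hTM k)⟩) * chainWeight A K B x =
      ∑' y, f y * ((∑' z, A z * transition K 0 (T (Fin.last n)) z (y (Fin.last n))) *
        (∏ k : Fin n, transition K (T k.succ) (T k.castSucc - T k.succ) (y k.succ)
          (y k.castSucc)) * ∑' z, transition K (T 0) (M - T 0) (y 0) z * B z) := by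
  classical
  induction n generalizing M B with
  | zero =>
    refine Eq.trans ?_ ((tsum_mul_chainWeight_split A K B (hTM 0) fun y _ => f fun _ => y).trans ?_)
    · exact tsum_congr fun x => by congr 2; funext k; rw [Fin.fin_one_eq_zero k]
    · refine Eq.trans ?_ (tsum_pi_one _).symm
      simp only [ENNReal.tsum_mul_left, tsum_chainWeight_single, Fin.last_zero,
        Finset.univ_eq_empty, Finset.prod_empty, mul_one, mul_assoc]
  | succ n ih =>
    have hT₀ (k : Fin (n + 1)) : T k.succ ≤ T 0 := hT (Fin.zero_le _)
    refine Eq.trans ?_ ((tsum_mul_chainWeight_split A K B (hTM 0) fun y x =>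
      f (Fin.cons y fun k => x ⟨T k.succ, Nat.lt_succ_of_le (hT₀ k)⟩)).trans ?_)
    · refine tsum_congr fun x => ?_
      congr 2
      exact (Fin.cons_self_tail _).symm
    rw [tsum_pi_cons]
    refine tsum_congr fun y => ?_
    rw [ih (T := fun k => T k.succ) _ (fun k k' hk => hT (Fin.succ_le_succ_iff.2 hk)) hT₀
      fun y' => f (Fin.cons y y'), ← ENNReal.tsum_mul_right]
    refine tsum_congr fun y' => ?_
    rw [Fin.prod_univ_succ, tsum_mul_single]
    simp only [← Fin.succ_last, Fin.cons_succ, Fin.cons_zero,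
      Fin.castSucc_zero, ← Fin.succ_castSucc]
    ring

end Chain

section Runs

theorem skewSchur_append (xs ys : List ℝ≥0) (l m : YoungDiagram) :
    skewSchur (xs ++ ys) l m = ∑' κ, skewSchur xs κ m * skewSchur ys l κ := by
  classical
  induction xs generalizing m with
  | nil => simp [skewSchur_nil]
  | cons x xs ih =>
    rw [List.cons_append, skewSchur_cons x (xs ++ ys)]
    simp only [ih, ← ENNReal.tsum_mul_left, ← mul_assoc]
    rw [ENNReal.tsum_comm]
    refine tsum_congr fun κ => ?_
    rw [ENNReal.tsum_mul_right, ← skewSchur_cons]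

theorem varsIoc_self (a : ℕ → ℝ≥0) (q : ℕ) : varsIoc a q q = [] := by
  simp [varsIoc]

theorem varsIoc_succ_right (a : ℕ → ℝ≥0) {p q : ℕ} (h : p ≤ q) :
    varsIoc a p (q + 1) = varsIoc a p q ++ [a (q + 1)] := by
  rw [varsIoc, List.Ico.succ_top (by omega), List.map_append]
  rfl

theorem varsIoc_eq_cons (a : ℕ → ℝ≥0) {p q : ℕ} (h : p < q) :
    varsIoc a p q = a (p + 1) :: varsIoc a (p + 1) q := by
  rw [varsIoc, List.Ico.eq_cons (by omega)]
  rfl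

variable (a : ℕ → ℝ≥0) (M : ℕ) (h : ℕ → ℕ)

/-- The transition weights at time `e` along the path with heights `h` which reaches the diagonal
at time `M`. -/
noncomputable def pathKernel (e : ℕ) : YoungDiagram → YoungDiagram → ℝ≥0∞ :=
  edgeKernel a (M - e + h e) (h e) (h (e + 1))

variable {M h}

theorem transition_pathKernel_up {s d q : ℕ} (hh : ∀ e ≤ d, h (s + e) = q + e)
    (y z : YoungDiagram) :
    transition (pathKernel a M h) s d y z = skewSchur (varsIoc a q (q + d)) z y := by
  classical
  induction d generalizing z with
  | zero => simp [transition, varsIoc_self, skewSchur_nil, eq_comm]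
  | succ d ih =>
    have h_succ : h (s + d + 1) = q + d + 1 := hh (d + 1) le_rfl
    simp only [transition, ih fun e he => hh e (he.trans d.le_succ), pathKernel, h_succ,
      hh d d.le_succ, edgeKernel_up]
    rw [← add_assoc, varsIoc_succ_right a (Nat.le_add_right q d), skewSchur_append]

theorem transition_pathKernel_level {s d p q : ℕ} (hh : ∀ e ≤ d, h (s + e) = q)
    (hp : p + d = M - s + q) (hd : s + d ≤ M) (y z : YoungDiagram) :
    transition (pathKernel a M h) s d y z = skewSchur (varsIoc a p (p + d)) y z := by
  classical
  induction d generalizing p z with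
  | zero => simp [transition, varsIoc_self, skewSchur_nil]
  | succ d ih =>
    have h_succ : h (s + d + 1) = q := hh (d + 1) le_rfl
    have abscissa : M - (s + d) + q = p + 1 := by omega
    simp only [transition, ih (p := p + 1) (fun e he => hh e (he.trans d.le_succ)) (by omega)
      (by omega), pathKernel, h_succ, hh d d.le_succ, edgeKernel_level, abscissa]
    rw [varsIoc_eq_cons a (show p < p + (d + 1) by omega), skewSchur_cons, add_right_comm,
      add_assoc p d 1]
    exact tsum_congr fun w => mul_comm _ _

end Runs

section CornerPath

variable {n : ℕ} {i j : Fin (n + 1) → ℕ}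

/-- The height at time `t` of the path from `(i_n, 0)` to the diagonal whose outer corners are among
the points `(i_k, j_k)`. -/
def cornerHeight (i j : Fin (n + 1) → ℕ) (t : ℕ) : ℕ :=
  Finset.univ.sup fun k => min (j k) (t + i k - i (Fin.last n))

/-- The time at which the path of `cornerHeight` passes through `(i_k, j_k)`. -/
def cornerTime (i j : Fin (n + 1) → ℕ) (k : Fin (n + 1)) : ℕ := i (Fin.last n) - i k + j k

theorem cornerHeight_eq {t : ℕ} (k : Fin (n + 1))
    (h : ∀ k', min (j k') (t + i k' - i (Fin.last n)) ≤ min (j k) (t + i k - i (Fin.last n))) :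
    cornerHeight i j t = min (j k) (t + i k - i (Fin.last n)) :=
  le_antisymm (Finset.sup_le fun k' _ => h k')
    (Finset.le_sup (f := fun k => min (j k) (t + i k - i (Fin.last n))) (Finset.mem_univ k))

theorem isHeight_cornerHeight (hi : Monotone i) :
    IsHeight (fun s : Fin (i (Fin.last n) + 1) => cornerHeight i j s) where
  zero := by
    refine Nat.eq_zero_of_le_zero (Finset.sup_le fun k _ => ?_)
    have := hi (Fin.le_last k)
    simp only [Fin.val_zero]
    omega
  step e := by
    have le_next : cornerHeight i j e ≤ cornerHeight i j (e + 1) :=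
      Finset.sup_mono_fun fun k _ => by omega
    have next_le : cornerHeight i j (e + 1) ≤ cornerHeight i j e + 1 := by
      refine Finset.sup_le fun k _ => ?_
      have : min (j k) (e + i k - i (Fin.last n)) ≤ cornerHeight i j e :=
        Finset.le_sup (f := fun k => min (j k) (e + i k - i (Fin.last n))) (Finset.mem_univ k)
      omega
    simp only [Fin.val_succ, Fin.val_castSucc]
    omega

theorem cornerTime_le (hi : Monotone i) (hij : ∀ k, j k ≤ i k) (k : Fin (n + 1)) :
    cornerTime i j k ≤ i (Fin.last n) := by
  have := hi (Fin.le_last k)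
  have := hij k
  rw [cornerTime]
  omega

theorem sub_cornerTime_add (hi : Monotone i) (hij : ∀ k, j k ≤ i k) (k : Fin (n + 1)) :
    i (Fin.last n) - cornerTime i j k + j k = i k := by
  have := hi (Fin.le_last k)
  have := hij k
  rw [cornerTime]
  omega

theorem antitone_cornerTime (hi : Monotone i) (hj : Antitone j) : Antitone (cornerTime i j) :=
  fun _ _ h => add_le_add (Nat.sub_le_sub_left (hi h) _) (hj h)

theorem cornerHeight_initial_run (hi : Monotone i) {e : ℕ} (he : e ≤ j (Fin.last n)) :
    cornerHeight i j e = e := by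
  rw [cornerHeight_eq (Fin.last n) fun k' => ?_]
  · omega
  · have := hi (Fin.le_last k')
    omega

theorem cornerHeight_final_run (hi : Monotone i) (hj : Antitone j) (e : ℕ) :
    cornerHeight i j (cornerTime i j 0 + e) = j 0 := by
  have := hi (Fin.le_last 0)
  rw [cornerTime, cornerHeight_eq 0 fun k' => ?_]
  · omega
  · have := hj (Fin.zero_le k')
    omega

theorem cornerHeight_level_run (hi : Monotone i) (hj : Antitone j) (k : Fin n) {e : ℕ}
    (he : e ≤ i k.succ - i k.castSucc) :
    cornerHeight i j (cornerTime i j k.succ + e) = j k.succ := by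
  have := hi (Fin.le_last k.succ)
  have := hi (Fin.castSucc_lt_succ (i := k)).le
  rw [cornerTime, cornerHeight_eq k.succ fun k' => ?_]
  · omega
  · rcases lt_or_ge k' k.succ with h | h
    · have := hi (Fin.le_castSucc_iff.2 h)
      omega
    · have := hj h
      omega

theorem cornerHeight_up_run (hi : Monotone i) (hj : Antitone j) (k : Fin n) {e : ℕ}
    (he : e ≤ j k.castSucc - j k.succ) :
    cornerHeight i j (cornerTime i j k.succ + (i k.succ - i k.castSucc) + e) = j k.succ + e := by
  have := hi (Fin.le_last k.succ)
  have := hi (Fin.castSucc_lt_succ (i := k)).le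
  have := hj (Fin.castSucc_lt_succ (i := k)).le
  rw [cornerTime, cornerHeight_eq k.castSucc fun k' => ?_]
  · omega
  · rcases lt_or_ge k' k.succ with h | h
    · have := hi (Fin.le_castSucc_iff.2 h)
      have := hj (Fin.le_castSucc_iff.2 h)
      omega
    · have := hj h
      omega

theorem cornerHeight_cornerTime (hi : Monotone i) (hj : Antitone j) (k : Fin (n + 1)) :
    cornerHeight i j (cornerTime i j k) = j k :=
  Fin.cases (cornerHeight_final_run hi hj 0)
    (fun k => cornerHeight_level_run hi hj k (Nat.zero_le _)) k

variable (a : ℕ → ℝ≥0)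

theorem transition_cornerHeight_initial (hi : Monotone i) (y z : YoungDiagram) :
    transition (pathKernel a (i (Fin.last n)) (cornerHeight i j)) 0 (cornerTime i j (Fin.last n))
      y z = skewSchur (varsIoc a 0 (j (Fin.last n))) z y := by
  rw [cornerTime, Nat.sub_self, zero_add]
  refine (transition_pathKernel_up a (q := 0) (fun e he => ?_) y z).trans (by rw [zero_add])
  rw [zero_add, cornerHeight_initial_run hi he]

theorem transition_cornerHeight_final (hi : Monotone i) (hj : Antitone j) (hij : ∀ k, j k ≤ i k)
    (y z : YoungDiagram) :
    transition (pathKernel a (i (Fin.last n)) (cornerHeight i j)) (cornerTime i j 0)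
      (i (Fin.last n) - cornerTime i j 0) y z = skewSchur (varsIoc a (j 0) (i 0)) y z := by
  have time_le := cornerTime_le hi hij 0
  have abscissa := sub_cornerTime_add hi hij 0
  have time_left : i (Fin.last n) - cornerTime i j 0 = i 0 - j 0 := by omega
  rw [time_left, transition_pathKernel_level a (fun e _ => cornerHeight_final_run hi hj e)
    (p := j 0) (by omega) (by omega), Nat.add_sub_cancel' (hij 0)]

theorem transition_cornerHeight (hi : Monotone i) (hj : Antitone j) (hij : ∀ k, j k ≤ i k)
    (k : Fin n) (y z : YoungDiagram) :
    transition (pathKernel a (i (Fin.last n)) (cornerHeight i j)) (cornerTime i j k.succ)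
        (cornerTime i j k.castSucc - cornerTime i j k.succ) y z =
      ∑' w, skewSchur (varsIoc a (j k.succ) (j k.castSucc)) z w *
        skewSchur (varsIoc a (i k.castSucc) (i k.succ)) y w := by
  have hik := hi (Fin.castSucc_lt_succ (i := k)).le
  have hjk := hj (Fin.castSucc_lt_succ (i := k)).le
  have time_le := cornerTime_le hi hij k.castSucc
  have time_succ_le := antitone_cornerTime hi hj (Fin.castSucc_lt_succ (i := k)).le
  have abscissa := sub_cornerTime_add hi hij k.castSucc
  have abscissa_succ := sub_cornerTime_add hi hij k.succ
  have time_between : cornerTime i j k.castSucc - cornerTime i j k.succ =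
      (i k.succ - i k.castSucc) + (j k.castSucc - j k.succ) := by
    omega
  rw [time_between, transition_add]
  refine tsum_congr fun w => ?_
  rw [transition_pathKernel_level a (fun e he => cornerHeight_level_run hi hj k he)
    (p := i k.castSucc) (by omega) (by omega),
    transition_pathKernel_up a fun e he => cornerHeight_up_run hi hj k he,
    Nat.add_sub_cancel' hik, Nat.add_sub_cancel' hjk, mul_comm]

end CornerPath

section PfaffianSchurProcess

variable {n : ℕ}

theorem tsum_mul_pfaffianSchurWeight (ρp ρm : Fin (n + 1) → List ℝ≥0)
    (f : (Fin (n + 1) → YoungDiagram) → ℝ≥0∞) :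
    ∑' s, f s.1 * pfaffianSchurWeight ρp ρm s =
      ∑' lam, f lam * (tauSchur (ρp 0) (lam 0) *
        (∏ k : Fin n, ∑' μ, skewSchur (ρm k.castSucc) (lam k.castSucc) μ *
          skewSchur (ρp k.succ) (lam k.succ) μ) *
        skewSchur (ρm (Fin.last n)) (lam (Fin.last n)) ⊥) := by
  rw [ENNReal.tsum_prod']
  simp only [pfaffianSchurWeight, ENNReal.tsum_mul_left, ENNReal.tsum_mul_right]
  exact tsum_congr fun lam => by rw [← tsum_pi_prod]

variable {a : ℕ → ℝ≥0} {c : ℝ≥0} {i j : Fin (n + 1) → ℕ}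

theorem tsum_mul_heightWeight_cornerHeight (hi : Monotone i) (hj : Antitone j)
    (hij : ∀ k, j k ≤ i k) (f : (Fin (n + 1) → YoungDiagram) → ℝ≥0∞) :
    ∑' lam, f (fun k => lam ⟨cornerTime i j k, Nat.lt_succ_of_le (cornerTime_le hi hij k)⟩) *
        heightWeight a c (fun s : Fin (i (Fin.last n) + 1) => cornerHeight i j s) lam =
      ∑' s, f s.1 * pfaffianSchurWeight (lppRhoPlus a c i j) (lppRhoMinus a j) s := by
  classical
  refine (tsum_mul_chainWeight_marginal (fun y => if y = ⊥ then 1 else 0)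
    (pathKernel a (i (Fin.last n)) (cornerHeight i j))
    (tauSchur [c]) (antitone_cornerTime hi hj) (cornerTime_le hi hij) f).trans ?_
  rw [tsum_mul_pfaffianSchurWeight]
  simp only [transition_cornerHeight_initial a hi, transition_cornerHeight_final a hi hj hij,
    transition_cornerHeight a hi hj hij, lppRhoPlus, lppRhoMinus, Fin.cons_zero, Fin.cons_succ,
    Fin.snoc_castSucc, Fin.snoc_last, tauSchur_cons c (varsIoc a (j 0) (i 0)),
    ite_mul, one_mul, zero_mul, tsum_ite_eq]
  simp only [mul_comm (tauSchur [c] _)]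
  exact tsum_congr fun lam => by ring

variable {Ω : Type*} [MeasurableSpace Ω] {P : Measure Ω} [IsProbabilityMeasure P]
  {g : ℕ → ℕ → Ω → ℕ}

theorem isProportionalLaw_pfaffianSchurWeight (hg : IsGeometricEnvironment P a c g)
    (hi : Monotone i) (hj : Antitone j) (hij : ∀ k, j k ≤ i k) :
    IsProportionalLaw (pfaffianSchurWeight (lppRhoPlus a c i j) (lppRhoMinus a j))
      (fun s k => (s.1 k).rowLen 0) P
      fun ω k => lastPassage (fun p q => g p q ω) (i k) (j k) := by
  have at_corners := (isProportionalLaw_heightWeight hg (isHeight_cornerHeight (j := j) hi)).comp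
    (φ := fun x k => x ⟨cornerTime i j k, Nat.lt_succ_of_le (cornerTime_le hi hij k)⟩)
    (by fun_prop)
  simp only [Function.comp_def, heightPassage, cornerHeight_cornerTime hi hj,
    sub_cornerTime_add hi hij] at at_corners
  exact at_corners.congr_weight fun f => (tsum_mul_heightWeight_cornerHeight hi hj hij
    fun y => f fun k => (y k).rowLen 0).symm

end PfaffianSchurProcess

theorem mainTheorem9_general {Ω : Type*} [MeasurableSpace Ω] {P : Measure Ω}
    [IsProbabilityMeasure P] {a : ℕ → ℝ≥0} {c : ℝ≥0} {g : ℕ → ℕ → Ω → ℕ}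
    (hg : IsGeometricEnvironment P a c g) {n : ℕ} {i j : Fin (n + 1) → ℕ}
    (hi : Monotone i) (hj : Antitone j) (hij : ∀ k, j k ≤ i k) :
    (IsProbabilityMeasure (pfaffianSchurLaw (lppRhoPlus a c i j) (lppRhoMinus a j)) ∧
      IdentDistrib
        (fun ω (k : Fin (n + 1)) => lastPassage (fun p q => g p q ω) (i k) (j k))
        (fun (s : (Fin (n + 1) → YoungDiagram) × (Fin n → YoungDiagram)) (k : Fin (n + 1)) =>
          (s.1 k).rowLen 0)
        P (pfaffianSchurLaw (lppRhoPlus a c i j) (lppRhoMinus a j))) ∧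
    (∀ (γ : ZigZagPath) (t : Fin (n + 1) → Fin (γ.len + 1)),
      (∀ k, γ.vertex (t k) = (i k, j k)) →
      IsProbabilityMeasure (γ.pfaffianSchurLaw [c] (γ.label a)) ∧
      IdentDistrib
        (fun ω (k : Fin (n + 1)) => lastPassage (fun p q => g p q ω) (i k) (j k))
        (fun (lam : Fin (γ.len + 1) → YoungDiagram) (k : Fin (n + 1)) => (lam (t k)).rowLen 0)
        P (γ.pfaffianSchurLaw [c] (γ.label a))) := by
  have passage_measurable : Measurable
      fun ω (k : Fin (n + 1)) => lastPassage (fun p q => g p q ω) (i k) (j k) :=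
    measurable_pi_lambda _ fun k => measurable_lastPassage (hij k) fun p q hq hqp _ _ =>
      hg.measurable p q hq hqp
  have firstRow_measurable : Measurable fun l : YoungDiagram => l.rowLen 0 := measurable_from_top
  refine ⟨(isProportionalLaw_pfaffianSchurWeight hg hi hj hij).identDistrib
    (measurable_pi_lambda _ fun k => by fun_prop) passage_measurable, fun γ t ht => ?_⟩
  have at_points := (γ.isProportionalLaw_weight hg).comp (φ := fun x k => x (t k)) (by fun_prop)
  simp only [Function.comp_def, ht] at at_points
  exact at_points.identDistrib (measurable_pi_lambda _ fun k => by simp only [firstRows]; fun_prop)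
    passage_measurable

theorem mainTheorem9
    {Ω : Type*} [MeasurableSpace Ω] (P : Measure Ω) [IsProbabilityMeasure P]
    (a : ℕ → ℝ≥0) (c : ℝ≥0)
    (ha : ∀ p, 1 ≤ p → 0 < a p) (hc : 0 < c)
    (haa : ∀ p q, 1 ≤ q → q < p → a p * a q < 1) (hca : ∀ p, 1 ≤ p → c * a p < 1)
    (g : ℕ → ℕ → Ω → ℕ)
    (hg_off : ∀ p q, 1 ≤ q → q < p → IsGeometric P (g p q) (a p * a q))
    (hg_diag : ∀ p, 1 ≤ p → IsGeometric P (g p p) (c * a p))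
    (hg_indep : iIndepFun
      (fun v : {v : ℕ × ℕ // 1 ≤ v.2 ∧ v.2 ≤ v.1} => g v.1.1 v.1.2) P)
    (n : ℕ) (i j : Fin (n + 1) → ℕ)
    (hi_pos : 0 < i 0) (hi : StrictMono i) (hj : StrictAnti j) (hij : ∀ k, j k ≤ i k) :
    (IsProbabilityMeasure (pfaffianSchurLaw (lppRhoPlus a c i j) (lppRhoMinus a j)) ∧
      IdentDistrib
        (fun ω (k : Fin (n + 1)) => lastPassage (fun p q => g p q ω) (i k) (j k))
        (fun (s : (Fin (n + 1) → YoungDiagram) × (Fin n → YoungDiagram)) (k : Fin (n + 1)) =>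
          (s.1 k).rowLen 0)
        P (pfaffianSchurLaw (lppRhoPlus a c i j) (lppRhoMinus a j))) ∧
    (∀ (γ : ZigZagPath) (t : Fin (n + 1) → Fin (γ.len + 1)),
      (∀ k, γ.vertex (t k) = (i k, j k)) →
      IsProbabilityMeasure (γ.pfaffianSchurLaw [c] (γ.label a)) ∧
      IdentDistrib
        (fun ω (k : Fin (n + 1)) => lastPassage (fun p q => g p q ω) (i k) (j k))
        (fun (lam : Fin (γ.len + 1) → YoungDiagram) (k : Fin (n + 1)) => (lam (t k)).rowLen 0)
        P (γ.pfaffianSchurLaw [c] (γ.label a))) := by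
  exact mainTheorem9_general ⟨haa, hca, hg_off, hg_diag, hg_indep⟩ hi.monotone hj.antitone hij
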